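/- **Model.** There are $n$ processes, with message buffers $\mathrm{Out}_{i\to j}$ and $\mathrm{In}_{i\to j}$ for all $i,j\in[n]$, initially empty. All processes are initially good. An adversary schedules an infinite sequence of events: $\mathrm{compute}(i)$ (process $i$ consumes all messages in its buffers $\mathrm{In}_{j\to i}$, changes state and deposits messages in its buffers $\mathrm{Out}_{i\to j}$), $\mathrm{deliver}(i,j)$ (some message is moved from $\mathrm{Out}_{i\to j}$ to $\mathrm{In}_{i\to j}$), and the adaptive corruption of a process, for at most $f$ processes altogether. At its compute events a good process follows the protocol; a corrupted process behaves arbitrarily, but messages cannot be forged or misdelivered. The execution is *fair* if every never-corrupted process has a compute event, and every message sent between two never-corrupted processes is eventually delivered and then followed by a compute event of its recipient. An *iterated blackboard* is a sequence $\mathsf{BB}_1,\mathsf{BB}_2,\dots$ of $m\times n$ matrices, initially all $\bot$, where column $i$ is written by process $i$ only. At a compute event a good process writes at most one cell of its column; it decides on the cell, and a fresh value is then generated (arbitrarily, from a given set $V$) and written. It writes the rows of each $\mathsf{BB}_t$ sequentially, only while it does not regard $\mathsf{BB}_t$ as complete, and, if $t>1$, only once it has fixed its view $\mathsf{BB}^{(i,t-1)}$.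 The true content of a cell $\mathsf{BB}_t(r,i)$ at a given time is the value $\neq\bot$ that some process has, while good, accepted for this cell by that time, and $\bot$ if there is none. Each process $p$ may at some time regard $\mathsf{BB}_t$ as complete, and may then fix a view $\mathsf{BB}^{(p,t)}=(\mathsf{BB}^{(p,t)}_1,\dots,\mathsf{BB}^{(p,t)}_t)$ of the history; $\mathsf{BB}_t$ is complete once some good process regards it as complete. **Theorem (Iterated Blackboard).** Let $n,f,m$ be natural numbers with $3f<n$ and let $V$ be a set. There is a protocol for $n$ processes that generates an iterated blackboard of $m\times n$ matrices with values in $V$, such that the following holds in every execution with at most $f$ corruptions. Good processes never accept different values for the same cell; a good process accepts for a cell of a process that is still good only the value that this process wrote; and what a good process has accepted, regarded as complete, or fixed never changes while it is good. For every $t\ge1$: 1. At all times each column of $\mathsf{BB}_t$ consists of a prefix of non-$\bot$ values followed by $\bot$s. From the time when $\mathsf{BB}_t$ is complete, it has at least $n-f$ full columns, and hence at most $f$ partial ones. 2. Suppose that a good process $p$ has fixed $\mathsf{BB}^{(p,t)}$. At this and any later time, let $\mathrm{last}(i)$ be the position $(t',r)$ of the last non-$\bot$ cell in column $i$ of $\mathsf{BB}_1,\dots,\mathsf{BB}_t$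 (undefined if there is none). Then for all $t'\in[t]$, $r\in[m]$, $i\in[n]$, $$\mathsf{BB}^{(p,t)}_{t'}(r,i)\ \begin{cases}=\mathsf{BB}_{t'}(r,i)&\text{if }\mathrm{last}(i)\ne(t',r),\\ \in\{\mathsf{BB}_{t'}(r,i),\bot\}&\text{otherwise,}\end{cases}$$ and $\mathsf{BB}^{(p,t)}$ differs from $(\mathsf{BB}_1,\dots,\mathsf{BB}_t)$ in at most $f$ cells in total. Likewise, the views $\mathsf{BB}^{(p,t)}$ and $\mathsf{BB}^{(p',t)}$ of any two good processes differ in at most $f$ cells in total. 3. For every process $q$ that at some time writes a non-$\bot$ value to $\mathsf{BB}_{t+1}$ (i.e. issues such a write while good, or has one accepted by a good process) there is a single history, its view $\mathsf{BB}^{(q,t)}$, known to every good process $p$ when $p$ fixes $\mathsf{BB}^{(p,t+1)}$ and from then on. It is the view that $q$ itself has fixed, if $q$ is good when it writes to $\mathsf{BB}_{t+1}$ or when $p$ has fixed $\mathsf{BB}^{(p,t+1)}$. If some good $p$ has fixed $\mathsf{BB}^{(p,t+1)}$, then from that time on $\mathsf{BB}^{(q,t)}$ satisfies the two relations to the true history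 in item 2, even if $q$ is corrupted. If the execution is fair, then every never-corrupted process eventually fixes its view $\mathsf{BB}^{(p,t)}$ for every $t\ge1$, and eventually accepts every value written by a never-corrupted process and every value accepted by any process while good. -/

import Mathlib

namespace Blackboard

universe u

/-- A sequence of `m × n` matrices; `H t r i` is the cell in row `r` of the column of process `i` of
the `t`-th matrix (`t = 1, 2, …`; index `0` is not used).  The blank symbol `⊥` is `none`. -/
abbrev History (m n : ℕ) (V : Type u) : Type u := ℕ → Matrix (Fin m) (Fin n) (Option V)

/-- A protocol for `n` processes communicating through message buffers.

At a compute event, process `i` in state `s`, holding the messages `inbox j` received from each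
process `j`, first decides (`target`) whether it writes to its own column and to which cell `(t, r)`;
then a fresh value `ζ` is generated, and `step` returns the new state and the messages deposited in
the buffers towards each process.

The remaining fields are what can be read off the local state of a process `p`. -/
structure Protocol (n m : ℕ) (V : Type u) where
  State : Type u
  Msg : Type u
  start : Fin n → State
  target : Fin n → State → (Fin n → Multiset Msg) → Option (ℕ × Fin m)
  step : Fin n → State → (Fin n → Multiset Msg) → V → State × (Fin n → Multiset Msg)
  /-- the writes to its own column that `p` has issued so far -/
  issued : State → ℕ → Fin m → Option V
  /-- the local matrices of `p`: the writes of all processes that `p` has accepted so far -/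
  accepted : State → History m n V
  /-- whether `p` regards the `t`-th matrix as complete -/
  complete : State → ℕ → Prop
  /-- the view of the history up to the `t`-th matrix that `p` has fixed, `none` if not yet fixed -/
  view : State → ℕ → Option (History m n V)
  /-- what `p` knows to be the view of process `q` of the history up to the `t`-th matrix -/
  aware : State → Fin n → ℕ → Option (History m n V)

variable {n m : ℕ} {V : Type u}

/-- A global configuration: the local states, the set of corrupted processes, and the buffers;
`out i j` is `Out_{i→j}` and `inb i j` is `In_{i→j}`. -/
structure Config (P : Protocol n m V) where
  state : Fin n → P.State
  bad : Finset (Fin n)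
  out : Fin n → Fin n → Multiset P.Msg
  inb : Fin n → Fin n → Multiset P.Msg

/-- The events scheduled by the adversary.  `compute i ζ` is a compute event of a good process, in
which `ζ` is the freshly generated value; `byzantine i s ms` is a compute event of a corrupted
process, with a state and messages chosen by the adversary. -/
inductive Event (P : Protocol n m V) where
  | compute (i : Fin n) (ζ : V)
  | byzantine (i : Fin n) (s : P.State) (ms : Fin n → Multiset P.Msg)
  | deliver (i j : Fin n) (x : P.Msg)
  | corrupt (i : Fin n)

/-- The effect of a compute event of process `i` that leads to state `s` and sends `ms`. -/
def Config.afterCompute {P : Protocol n m V} (c : Config P) (i : Fin n) (s : P.State)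
    (ms : Fin n → Multiset P.Msg) : Config P where
  state := Function.update c.state i s
  bad := c.bad
  out := Function.update c.out i (fun j => c.out i j + ms j)
  inb := fun j => Function.update (c.inb j) i 0

/-- `Step f c a c'`: in configuration `c` event `a` may happen, and it leads to `c'`, where at most
`f` processes may ever be corrupted. -/
def Step {P : Protocol n m V} (f : ℕ) (c : Config P) : Event P → Config P → Prop
  | .compute i ζ, c' =>
      i ∉ c.bad ∧
      c' = c.afterCompute i (P.step i (c.state i) (fun j => c.inb j i) ζ).1
        (P.step i (c.state i) (fun j => c.inb j i) ζ).2
  | .byzantine i s ms, c' => i ∈ c.bad ∧ c' = c.afterCompute i s ms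
  | .deliver i j x, c' =>
      ∃ rest, c.out i j = x ::ₘ rest ∧
        c' = { c with
          out := Function.update c.out i (Function.update (c.out i) j rest)
          inb := Function.update c.inb i (Function.update (c.inb i) j (x ::ₘ c.inb i j)) }
  | .corrupt i, c' => i ∉ c.bad ∧ c.bad.card < f ∧ c' = { c with bad := insert i c.bad }

/-- An infinite execution of `P` against an adaptive adversary that corrupts at most `f` processes.
At first all processes are good and all buffers are empty. -/
structure Execution (P : Protocol n m V) (f : ℕ) where
  conf : ℕ → Config P
  event : ℕ → Event P
  conf_zero : conf 0 = ⟨P.start, ∅, fun _ _ => 0, fun _ _ => 0⟩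
  conf_succ : ∀ τ, Step f (conf τ) (event τ) (conf (τ + 1))

namespace Execution

variable {P : Protocol n m V} {f : ℕ} (e : Execution P f)

/-- The local state of process `p` at time `τ`. -/
def st (τ : ℕ) (p : Fin n) : P.State := (e.conf τ).state p

/-- Process `p` has not been corrupted by time `τ`. -/
def Good (τ : ℕ) (p : Fin n) : Prop := p ∉ (e.conf τ).bad

/-- Process `p` is never corrupted. -/
def AlwaysGood (p : Fin n) : Prop := ∀ τ, e.Good τ p

/-- The adversary must let the good processes make progress: each of them has a compute event, and
each message from one to another is eventually delivered and then followed by a compute event of its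
recipient. -/
def Fair : Prop :=
  (∀ i, e.AlwaysGood i → ∃ τ ζ, e.event τ = .compute i ζ) ∧
  (∀ i j, e.AlwaysGood i → e.AlwaysGood j → ∀ τ, ∀ x ∈ (e.conf τ).out i j,
    ∃ τ' ≥ τ, e.event τ' = .deliver i j x) ∧
  (∀ i j, e.AlwaysGood i → e.AlwaysGood j → ∀ τ x, e.event τ = .deliver i j x →
    ∃ τ' > τ, ∃ ζ, e.event τ' = .compute j ζ)

/-- `BB τ` is the true sequence of blackboards at time `τ`: a cell holds the value that some process
accepted for it, while good, at time `τ` or before (in particular, good processes never accept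
different values for the same cell). -/
def IsTrueBlackboard (BB : ℕ → History m n V) : Prop :=
  ∀ τ t r i v, BB τ t r i = some v ↔
    ∃ σ ≤ τ, ∃ p, e.Good σ p ∧ P.accepted (e.st σ p) t r i = some v

/-- The rules of writing.  Everything is blank at first.  At a compute event of a good process
nothing or exactly one cell of its column is written, with the value generated at this event.  The
rows of a matrix are written one after the other, only after the view of the history through the
previous matrix has been fixed, and only while the process does not regard the matrix as complete.
A column of a good process holds nothing but writes issued by this process. -/
def WritesProperly (BB : ℕ → History m n V) : Prop :=
  (∀ i t r, P.issued (P.start i) t r = none) ∧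
  (∀ τ i ζ, e.event τ = .compute i ζ →
    match P.target i (e.st τ i) (fun j => (e.conf τ).inb j i) with
    | none => P.issued (e.st (τ + 1) i) = P.issued (e.st τ i)
    | some (t, r) =>
        1 ≤ t ∧ P.issued (e.st τ i) t r = none ∧
        P.issued (e.st (τ + 1) i) t r = some ζ ∧
        (∀ t' r', (t', r') ≠ (t, r) →
          P.issued (e.st (τ + 1) i) t' r' = P.issued (e.st τ i) t' r') ∧
        (∀ r' < r, P.issued (e.st τ i) t r' ≠ none) ∧
        (1 < t → P.view (e.st (τ + 1) i) (t - 1) ≠ none) ∧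
        ¬ P.complete (e.st τ i) t) ∧
  (∀ τ i, e.Good τ i → ∀ t ≥ 1, ∀ r v,
    BB τ t r i = some v → P.issued (e.st τ i) t r = some v)

/-- What a good process has accepted, regarded as complete or fixed stays so, and a view is fixed
only when the matrix is complete. -/
def Persistent : Prop :=
  ∀ p τ τ', τ ≤ τ' → e.Good τ' p → ∀ t ≥ 1,
    (∀ r i v, P.accepted (e.st τ p) t r i = some v → P.accepted (e.st τ' p) t r i = some v) ∧
    (P.complete (e.st τ p) t → P.complete (e.st τ' p) t) ∧
    (∀ h, P.view (e.st τ p) t = some h → P.view (e.st τ' p) t = some h) ∧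
    (P.view (e.st τ p) t ≠ none → P.complete (e.st τ p) t)

/-- By time `τ`, the `t`-th matrix has been regarded as complete by some good process. -/
def CompleteBy (τ t : ℕ) : Prop := ∃ σ ≤ τ, ∃ p, e.Good σ p ∧ P.complete (e.st σ p) t

/-- At some time, process `q` writes a value to the `t`-th matrix: a value in its column is accepted
by some good process, or it issues such a write while good. -/
def WritesTo (BB : ℕ → History m n V) (q : Fin n) (t : ℕ) : Prop :=
  ∃ τ r, BB τ t r q ≠ none ∨ (e.Good τ q ∧ P.issued (e.st τ q) t r ≠ none)

end Execution

/-- `(t', r)` is the position of the last value in column `i` of the matrices `1, …, t` of `B`. -/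
def IsLast (B : History m n V) (t : ℕ) (i : Fin n) (t' : ℕ) (r : Fin m) : Prop :=
  1 ≤ t' ∧ t' ≤ t ∧ B t' r i ≠ none ∧
    ∀ t'' r', 1 ≤ t'' → t'' ≤ t → B t'' r' i ≠ none → t'' < t' ∨ (t'' = t' ∧ r' ≤ r)

/-- On the matrices `1, …, t`, `h` equals `B` except that the last written cell of each process may
read `⊥`. -/
def AgreesUpToLast (B : History m n V) (t : ℕ) (h : History m n V) : Prop :=
  ∀ t', 1 ≤ t' → t' ≤ t → ∀ r i,
    (¬ IsLast B t i t' r → h t' r i = B t' r i) ∧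
    (IsLast B t i t' r → h t' r i = B t' r i ∨ h t' r i = none)

/-- The cells of the matrices `1, …, t` on which two histories differ. -/
def disagreements (t : ℕ) (h h' : History m n V) : Set (ℕ × Fin m × Fin n) :=
  {x | 1 ≤ x.1 ∧ x.1 ≤ t ∧ h x.1 x.2.1 x.2.2 ≠ h' x.1 x.2.1 x.2.2}

/-- Column `i` of the matrix `M` is full. -/
def FullColumn (M : Matrix (Fin m) (Fin n) (Option V)) (i : Fin n) : Prop :=
  ∀ r, M r i ≠ none

end Blackboard

namespace Blackboard

universe u

/-! Every process keeps an append-only log, adds one entry at each compute event, and spreads it by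
Bracha's reliable broadcast. As `3 * f < n`, any three sets of at least `n - f` processes meet.
Applied to the never-corrupted processes and two echo quorums, this shows that good processes never
accept different entries for the same author and position (`acceptedEver_unique`). An entry carries
a vector clock of the logs its author had accepted, and it is accepted only if it is legal relative
to the logs below that clock. A corrupted process can therefore only contribute a legal log or
stall: `AcceptedEver` is one `Coherent` collection. Anyone whose logs cover a clock can recompute
the view taken at that clock (`cut_log`).

Views are synchronised by acknowledgements. An entry is acknowledged for matrix `t` when `n - f`
authors have shown, by entries of level below `t`, that they had accepted it. Fixing a view of `t`
requires completion entries for `t` from `n - f` authors. Clocks and levels are monotone along a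
log, so an author in both quorums acknowledged before it completed, and every view of `t` contains
all that was acknowledged for some `s ≤ t` (`Coherent.clock_lt`). Three rules exploit this. A write
needs all earlier non-tick entries of its author acknowledged, so a view can miss only the last
write of a column (`Coherent.agreesUpToLast`). Completion needs `n - f` fully written and
acknowledged columns. These are full in all views, and each of the other columns, at most `f`,
contributes at most one disagreement (`encard_disagreements_le`). The entry fixing `t` must be
acknowledged before a write to `t + 1`, so whoever fixes `t + 1` knows that entry and its clock
(`known_of_view`).

Progress is by induction on `t`. Once all never-corrupted processes have fixed `t`, either one of
them completes `t + 1`, and its evidence, made of accepted entries, reaches the others; or none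
does, their levels stay below `t + 1`, acknowledgements never dry up, and their columns fill and
close. Completions are then reported and views get fixed. -/

/-- The operation carried by a log entry. -/
inductive Op (m : ℕ) (V : Type u) where
  | tick
  | complete (t : ℕ)
  | fix (t : ℕ)
  | write (t : ℕ) (r : Fin m) (v : V)

/-- A log entry: the lengths of the logs accepted by its author, the number of matrices its author
regards as complete, and an operation. -/
structure Entry (n m : ℕ) (V : Type u) where
  clock : Fin n → ℕ
  lev : ℕ
  op : Op m V

/-- The slots of a reliable broadcast of log entries. -/
inductive Tag (n : ℕ) where
  | init (k : ℕ)
  | echo (i : Fin n) (k : ℕ)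
  | ready (i : Fin n) (k : ℕ)

/-- A message: everything its sender has said so far. -/
abbrev Packet (n m : ℕ) (V : Type u) : Type u := Tag n → Option (Entry n m V)

/-- A collection of log entries, indexed by author and position. -/
abbrev Entries (n m : ℕ) (V : Type u) : Type u := Fin n → ℕ → Entry n m V → Prop

/-- The local state of a process: its own log entries, the numbers of matrices completed and fixed,
its echoes and confirmations, what it has heard from each process in each slot, and the logs it has
accepted. -/
structure LState (n m : ℕ) (V : Type u) where
  own : List (Entry n m V)
  done : ℕ
  fixed : ℕ
  echo : Fin n → ℕ → Option (Entry n m V)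
  ready : Fin n → ℕ → Option (Entry n m V)
  heard : Fin n → Tag n → Set (Entry n m V)
  logs : Fin n → List (Entry n m V)

variable {n m : ℕ} {V : Type u}

/-! ### Choice from sets -/

open Classical in
/-- Some element of a set, if there is one. -/
noncomputable def pick {α : Type*} (S : Set α) : Option α :=
  if h : S.Nonempty then some h.some else none

/-- Keep a choice made earlier, or else choose an element of `S`. -/
noncomputable def keep {α : Type*} (a : Option α) (S : Set α) : Option α :=
  match a with
  | some x => some x
  | none => pick S

theorem mem_of_pick {α : Type*} {S : Set α} {x : α} (h : pick S = some x) : x ∈ S := by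
  unfold pick at h
  split_ifs at h with hS
  cases h
  exact hS.some_mem

theorem pick_ne_none {α : Type*} {S : Set α} (h : S.Nonempty) : pick S ≠ none := by
  simp [pick, h]

theorem nonempty_of_pick {α : Type*} {S : Set α} (h : pick S ≠ none) : S.Nonempty := by
  by_contra hS
  simp [pick, hS] at h

theorem pick_eq_some {α : Type*} {S : Set α} (hS : ∀ x ∈ S, ∀ y ∈ S, x = y) {x : α} :
    pick S = some x ↔ x ∈ S := by
  refine ⟨mem_of_pick, fun hx => ?_⟩
  obtain ⟨y, hy⟩ := Option.ne_none_iff_exists'.1 (pick_ne_none ⟨x, hx⟩)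
  rw [hy, hS y (mem_of_pick hy) x hx]

theorem keep_eq_some {α : Type*} {a : Option α} {S : Set α} {x : α} (h : keep a S = some x) :
    a = some x ∨ x ∈ S := by
  cases a with
  | none => exact Or.inr (mem_of_pick h)
  | some y => exact Or.inl h

theorem keep_of_some {α : Type*} {a : Option α} (S : Set α) {x : α} (h : a = some x) :
    keep a S = some x := by
  subst h; rfl

theorem keep_ne_none {α : Type*} (a : Option α) {S : Set α} (h : S.Nonempty) :
    keep a S ≠ none := by
  cases a with
  | none => exact pick_ne_none h
  | some y => simp [keep]

/-! ### Legality of log entries -/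

/-- All but at most `f` processes satisfy `p`. -/
def Many (f : ℕ) (p : Fin n → Prop) : Prop := n ≤ {j | p j}.ncard + f

theorem Many.mono {f : ℕ} {p q : Fin n → Prop} (h : Many f p) (hpq : ∀ j, p j → q j) :
    Many f q :=
  le_trans h (Nat.add_le_add_right (Set.ncard_le_ncard (fun j hj => hpq j hj)) f)

/-- The entries listed in `L`. -/
def rel (L : Fin n → List (Entry n m V)) : Entries n m V := fun j k e => (L j)[k]? = some e

/-- The entries of `E` at positions below `C`. -/
def cut (E : Entries n m V) (C : Fin n → ℕ) : Entries n m V := fun j k e => k < C j ∧ E j k e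

/-- The `k`-th entry of `j` was known to `n - f` processes before they completed matrix `t`. -/
def Acked (f : ℕ) (R : Entries n m V) (j : Fin n) (k t : ℕ) : Prop :=
  Many f fun y => ∃ l e, R y l e ∧ k < e.clock j ∧ e.lev < t

/-- All cells of column `j` of matrix `t` are written and acknowledged. -/
def ClosedColumn (f : ℕ) (R : Entries n m V) (t : ℕ) (j : Fin n) : Prop :=
  ∀ r, ∃ k e v, R j k e ∧ e.op = .write t r v ∧ Acked f R j k t

def Closed (f : ℕ) (R : Entries n m V) (t : ℕ) : Prop := Many f (ClosedColumn f R t)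

def Reported (f : ℕ) (R : Entries n m V) (t : ℕ) : Prop :=
  Many f fun y => ∃ l e, R y l e ∧ e.op = .complete t

/-- Process `i` with previous entries `O` may write to the cell `(t, r)` when it knows `R`. -/
structure WriteOK (f : ℕ) (O : ℕ → Entry n m V → Prop) (R : Entries n m V) (i : Fin n)
    (t : ℕ) (r : Fin m) : Prop where
  pos : 1 ≤ t
  lex : ∀ k x t' r' v', O k x → x.op = .write t' r' v' → t' < t ∨ (t' = t ∧ r' < r)
  rows : ∀ r' < r, ∃ k x v', O k x ∧ x.op = .write t r' v'
  fixed : 1 < t → ∃ k x, O k x ∧ x.op = .fix (t - 1)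
  -- Ticks are exempt: a process waiting for acknowledgements keeps issuing them, so its log may
  -- always run ahead of what has been acknowledged.
  acked : ∀ k x, O k x → x.op ≠ .tick → Acked f R i k t

/-- The level of a completion entry already counts the matrix being completed, whereas
acknowledgements for `t` have level below `t`. This separates the two in time. -/
def ValidOp (f : ℕ) (O : ℕ → Entry n m V → Prop) (R : Entries n m V) (i : Fin n) (lev : ℕ) :
    Op m V → Prop
  | .tick => True
  | .complete t => lev = t ∧ Closed f R t
  | .fix t => (∃ k x, O k x ∧ x.op = .complete t) ∧ Reported f R t ∧
      ∀ k x, O k x → x.op ≠ .fix t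
  | .write t r _ => WriteOK f O R i t r

/-- `e` is a legal entry of process `i` after the entries `O`, where `R` are the entries below the
clock of `e`. -/
structure Valid (f : ℕ) (O : ℕ → Entry n m V → Prop) (R : Entries n m V) (i : Fin n)
    (e : Entry n m V) : Prop where
  own_le : ∀ k x, O k x → x.clock ≤ e.clock ∧ x.lev ≤ e.lev
  past_le : ∀ j k x, R j k x → x.clock ≤ e.clock
  op : ValidOp f O R i e.lev e.op

/-- The entry `e` may be appended to the log of `i` among the logs `L`. -/
def Acceptable (f : ℕ) (L : Fin n → List (Entry n m V)) (i : Fin n) (e : Entry n m V) : Prop :=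
  (∀ j, e.clock j ≤ (L j).length) ∧
    Valid f (fun k x => (L i)[k]? = some x) (cut (rel L) e.clock) i e

/-- The history written in the entries `R`. -/
noncomputable def hist (R : Entries n m V) : History m n V :=
  fun t r i => pick {v | ∃ k e, R i k e ∧ e.op = .write t r v}

/-- The entries `e` that have been confirmed as the `k`-th one of `i`. -/
def Delivered (f : ℕ) (heard : Fin n → Tag n → Set (Entry n m V)) (i : Fin n) (k : ℕ)
    (e : Entry n m V) : Prop :=
  Many f fun z => e ∈ heard z (.ready i k)

/-- The two triggers of Bracha's broadcast. More than `f` confirmations must include one from a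
never-corrupted process. -/
def ReadyCause (f : ℕ) (heard : Fin n → Tag n → Set (Entry n m V)) (i : Fin n) (k : ℕ)
    (e : Entry n m V) : Prop :=
  Many f (fun z => e ∈ heard z (.echo i k)) ∨ f < {z | e ∈ heard z (.ready i k)}.ncard

/-! ### Transitions of a process -/

namespace LState

def said (s : LState n m V) : Packet n m V
  | .init k => s.own[k]?
  | .echo i k => s.echo i k
  | .ready i k => s.ready i k

def initial : LState n m V where
  own := []
  done := 0
  fixed := 0
  echo := fun _ _ => none
  ready := fun _ _ => none
  heard := fun _ _ => ∅
  logs := fun _ => []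

/-- Process `i` may now write to the cell `(s.done + 1, r)`. -/
def CanWrite (f : ℕ) (i : Fin n) (s : LState n m V) (r : Fin m) : Prop :=
  WriteOK f (fun k x => s.own[k]? = some x) (rel s.logs) i (s.done + 1) r

open Classical in
/-- The cell to which process `i` writes next. -/
noncomputable def nextCell (f : ℕ) (i : Fin n) (s : LState n m V) : Option (ℕ × Fin m) :=
  if s.fixed < s.done ∨ Closed f (rel s.logs) (s.done + 1) then none
  else (pick {r | s.CanWrite f i r}).map fun r => (s.done + 1, r)

-- A process that has completed a matrix only ticks until it can fix its view, so completions and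
-- fixes alternate. Completing has priority over writing.
open Classical in
noncomputable def nextOp (f : ℕ) (i : Fin n) (s : LState n m V) (ζ : V) : Op m V :=
  if s.fixed < s.done then
    if Reported f (rel s.logs) s.done then .fix s.done else .tick
  else if Closed f (rel s.logs) (s.done + 1) then .complete (s.done + 1)
  else match pick {r | s.CanWrite f i r} with
    | some r => .write (s.done + 1) r ζ
    | none => .tick

def doneAfter (s : LState n m V) : Op m V → ℕ
  | .complete t => t
  | _ => s.done

def fixedAfter (s : LState n m V) : Op m V → ℕ
  | .fix t => t
  | _ => s.fixed

noncomputable def nextEntry (f : ℕ) (i : Fin n) (s : LState n m V) (ζ : V) : Entry n m V where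
  clock := fun j => (s.logs j).length
  lev := s.doneAfter (s.nextOp f i ζ)
  op := s.nextOp f i ζ

/-- A set is recorded because a corrupted sender may put several entries into one slot. -/
def hear (s : LState n m V) (inbox : Fin n → Multiset (Packet n m V)) (j : Fin n) (g : Tag n) :
    Set (Entry n m V) :=
  s.heard j g ∪ {x | ∃ M ∈ inbox j, M g = some x}

/-- The new entry, and the legality test for incoming entries, refer to the logs held before the
event; the messages just received count only for echoes, confirmations and deliveries. At most one
entry per author is accepted at each event. -/
noncomputable def next (f : ℕ) (i : Fin n) (s : LState n m V)
    (inbox : Fin n → Multiset (Packet n m V)) (ζ : V) : LState n m V where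
  own := s.own ++ [s.nextEntry f i ζ]
  done := s.doneAfter (s.nextOp f i ζ)
  fixed := s.fixedAfter (s.nextOp f i ζ)
  echo := fun j k => keep (s.echo j k) (s.hear inbox j (.init k))
  ready := fun j k => keep (s.ready j k) {e | ReadyCause f (s.hear inbox) j k e}
  heard := s.hear inbox
  logs := fun j => s.logs j ++ (pick {e | Delivered f (s.hear inbox) j (s.logs j).length e ∧
    Acceptable f s.logs j e}).toList

end LState

/-- The entries of a list below position `k`. -/
def before (l : List (Entry n m V)) (k : ℕ) : ℕ → Entry n m V → Prop :=
  fun k' x => k' < k ∧ l[k']? = some x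

/-- The protocol: log entries are broadcast reliably and accepted in causal order. -/
noncomputable def logProtocol (n m : ℕ) (V : Type u) (f : ℕ) : Protocol n m V where
  State := LState n m V
  Msg := Packet n m V
  start := fun _ => .initial
  target := fun i s _ => s.nextCell f i
  step := fun i s inbox ζ => (s.next f i inbox ζ, fun _ => {(s.next f i inbox ζ).said})
  issued := fun s t r => pick {v | ∃ (k : ℕ) (e : Entry n m V), s.own[k]? = some e ∧
    e.op = .write t r v}
  accepted := fun s => hist (rel s.logs)
  complete := fun s t => ∃ (k : ℕ) (e : Entry n m V), s.own[k]? = some e ∧ e.op = .complete t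
  view := fun s t => pick {h | ∃ (k : ℕ) (e : Entry n m V), s.own[k]? = some e ∧ e.op = .fix t ∧
    h = hist (cut (rel s.logs) e.clock)}
  aware := fun s q t => pick {h | ∃ (k : ℕ) (e : Entry n m V), (s.logs q)[k]? = some e ∧
    e.op = .fix t ∧ h = hist (cut (rel s.logs) e.clock)}

/-! ### Local invariants -/

theorem getElem?_of_prefix {α : Type*} {l l' : List α} (h : l <+: l') {k : ℕ} {x : α}
    (hx : l[k]? = some x) : l'[k]? = some x := by
  obtain ⟨t, rfl⟩ := h
  rw [List.getElem?_append_left (List.getElem?_eq_some_iff.1 hx).1, hx]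

theorem getElem?_eq_of_prefix {α : Type*} {l l' : List α} (h : l <+: l') {k : ℕ}
    (hk : k < l.length) : l'[k]? = l[k]? := by
  obtain ⟨t, rfl⟩ := h
  rw [List.getElem?_append_left hk]

/-- What lies below a covered clock is frozen, so legality checks and views survive the growth of
the logs. -/
theorem cut_rel_eq {L L' : Fin n → List (Entry n m V)} (h : ∀ j, L j <+: L' j) {C : Fin n → ℕ}
    (hC : ∀ j, C j ≤ (L j).length) : cut (rel L') C = cut (rel L) C := by
  funext j k e
  simp only [cut, rel, eq_iff_iff]
  refine and_congr_right fun hk => ?_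
  rw [getElem?_eq_of_prefix (h j) (lt_of_lt_of_le hk (hC j))]

theorem cut_rel_length (L : Fin n → List (Entry n m V)) :
    cut (rel L) (fun j => (L j).length) = rel L := by
  funext j k e
  simp only [cut, rel, eq_iff_iff, and_iff_right_iff_imp]
  exact fun h => (List.getElem?_eq_some_iff.1 h).1

theorem before_eq {l l' : List (Entry n m V)} (h : l <+: l') {k : ℕ} (hk : k ≤ l.length) :
    before l' k = before l k := by
  funext k' e
  simp only [before, eq_iff_iff]
  refine and_congr_right fun hk' => ?_
  rw [getElem?_eq_of_prefix h (lt_of_lt_of_le hk' hk)]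

theorem before_length (l : List (Entry n m V)) :
    before l l.length = fun k x => l[k]? = some x := by
  funext j e
  simp only [before, eq_iff_iff, and_iff_right_iff_imp]
  exact fun h => (List.getElem?_eq_some_iff.1 h).1

theorem getElem?_concat {α : Type*} {l : List α} {a x : α} {k : ℕ}
    (h : (l ++ [a])[k]? = some x) : l[k]? = some x ∨ (k = l.length ∧ x = a) := by
  rcases lt_trichotomy k l.length with hk | hk | hk
  · rw [List.getElem?_append_left hk] at h; exact Or.inl h
  · subst hk; simp at h; exact Or.inr ⟨rfl, h.symm⟩
  · have := (List.getElem?_eq_some_iff.1 h).1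
    simp at this; omega

theorem getElem?_concat_toList {α : Type*} {l : List α} {a : Option α} {x : α} {k : ℕ}
    (h : (l ++ a.toList)[k]? = some x) : l[k]? = some x ∨ (k = l.length ∧ a = some x) := by
  cases a with
  | none => simp at h; exact Or.inl h
  | some y =>
    rcases getElem?_concat h with h' | ⟨h', rfl⟩
    · exact Or.inl h'
    · exact Or.inr ⟨h', by simp⟩

/-- Later states extend earlier ones. -/
structure Grows (s s' : LState n m V) : Prop where
  own : s.own <+: s'.own
  done : s.done ≤ s'.done
  fixed : s.fixed ≤ s'.fixed
  echo : ∀ i k e, s.echo i k = some e → s'.echo i k = some e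
  ready : ∀ i k e, s.ready i k = some e → s'.ready i k = some e
  heard : ∀ i g, s.heard i g ⊆ s'.heard i g
  logs : ∀ i, s.logs i <+: s'.logs i

theorem Grows.rfl {s : LState n m V} : Grows s s :=
  ⟨List.prefix_rfl, le_rfl, le_rfl, fun _ _ _ h => h, fun _ _ _ h => h, fun _ _ => subset_rfl,
    fun _ => List.prefix_rfl⟩

theorem Grows.trans {s s' s'' : LState n m V} (h : Grows s s') (h' : Grows s' s'') :
    Grows s s'' :=
  ⟨h.own.trans h'.own, h.done.trans h'.done, h.fixed.trans h'.fixed,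
    fun _ _ _ hx => h'.echo _ _ _ (h.echo _ _ _ hx),
    fun _ _ _ hx => h'.ready _ _ _ (h.ready _ _ _ hx),
    fun i g => (h.heard i g).trans (h'.heard i g), fun i => (h.logs i).trans (h'.logs i)⟩

/-- Slots are written once, so a packet that was true when sent stays true of its sender as long as
the sender is good. -/
theorem Grows.said {s s' : LState n m V} (h : Grows s s') {g : Tag n} {e : Entry n m V}
    (he : s.said g = some e) : s'.said g = some e := by
  cases g with
  | init k => exact getElem?_of_prefix h.own he
  | echo i k => exact h.echo _ _ _ he
  | ready i k => exact h.ready _ _ _ he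

theorem Delivered.mono {f : ℕ} {H H' : Fin n → Tag n → Set (Entry n m V)}
    (h : ∀ i g, H i g ⊆ H' i g) {i : Fin n} {k : ℕ} {e : Entry n m V}
    (hd : Delivered f H i k e) : Delivered f H' i k e :=
  Many.mono hd fun _ hz => h _ _ hz

theorem ReadyCause.mono {f : ℕ} {H H' : Fin n → Tag n → Set (Entry n m V)}
    (h : ∀ i g, H i g ⊆ H' i g) {i : Fin n} {k : ℕ} {e : Entry n m V}
    (hd : ReadyCause f H i k e) : ReadyCause f H' i k e :=
  hd.imp (fun hd => Many.mono hd fun _ hz => h _ _ hz)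
    fun hd => lt_of_lt_of_le hd (Set.ncard_le_ncard fun _ hz => h _ _ hz)

/-- What holds in every state of a process `p` that follows the protocol. -/
structure Sound (f : ℕ) (p : Fin n) (s : LState n m V) : Prop where
  echo_heard : ∀ i k e, s.echo i k = some e → e ∈ s.heard i (.init k)
  ready_cause : ∀ i k e, s.ready i k = some e → ReadyCause f s.heard i k e
  echo_ne_none : ∀ i k e, e ∈ s.heard i (.init k) → s.echo i k ≠ none
  ready_ne_none : ∀ i k e, ReadyCause f s.heard i k e → s.ready i k ≠ none
  delivered : ∀ i k e, (s.logs i)[k]? = some e → Delivered f s.heard i k e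
  logs_valid : ∀ i k e, (s.logs i)[k]? = some e → (∀ j, e.clock j ≤ (s.logs j).length) ∧
    Valid f (before (s.logs i) k) (cut (rel s.logs) e.clock) i e
  own_valid : ∀ k e, s.own[k]? = some e → (∀ j, e.clock j ≤ (s.logs j).length) ∧
    Valid f (before s.own k) (cut (rel s.logs) e.clock) p e
  lev_le : ∀ (k : ℕ) (e : Entry n m V), s.own[k]? = some e → e.lev ≤ s.done
  fixed_le : s.fixed ≤ s.done
  done_le : s.done ≤ s.fixed + 1
  complete_iff : ∀ t, (∃ (k : ℕ) (e : Entry n m V), s.own[k]? = some e ∧ e.op = .complete t) ↔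
    1 ≤ t ∧ t ≤ s.done
  fix_iff : ∀ t, (∃ (k : ℕ) (e : Entry n m V), s.own[k]? = some e ∧ e.op = .fix t) ↔
    1 ≤ t ∧ t ≤ s.fixed
  write_le : ∀ (k : ℕ) (e : Entry n m V) t r v, s.own[k]? = some e → e.op = .write t r v →
    t ≤ s.fixed + 1

theorem sound_initial (f : ℕ) (hf : 2 * f < n) (p : Fin n) :
    Sound f p (LState.initial : LState n m V) := by
  constructor <;> simp [LState.initial, ReadyCause, Many]
  · omega
  · omega
  · omega

theorem next_cases (f : ℕ) (i : Fin n) (s : LState n m V) (ζ : V) :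
    (s.nextOp f i ζ = .tick) ∨
    (s.fixed < s.done ∧ Reported f (rel s.logs) s.done ∧ s.nextOp f i ζ = .fix s.done) ∨
    (¬ s.fixed < s.done ∧ Closed f (rel s.logs) (s.done + 1) ∧
      s.nextOp f i ζ = .complete (s.done + 1)) ∨
    (¬ s.fixed < s.done ∧ ¬ Closed f (rel s.logs) (s.done + 1) ∧ ∃ r, s.CanWrite f i r ∧
      s.nextCell f i = some (s.done + 1, r) ∧ s.nextOp f i ζ = .write (s.done + 1) r ζ) := by
  unfold LState.nextOp LState.nextCell
  by_cases h1 : s.fixed < s.done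
  · by_cases h2 : Reported f (rel s.logs) s.done <;> simp [h1, h2]
  · by_cases h2 : Closed f (rel s.logs) (s.done + 1)
    · simp [h1, h2]
    · rcases h3 : pick {r | s.CanWrite f i r} with _ | r
      · simp [h1, h2]
      · have := mem_of_pick h3
        right; right; right
        exact ⟨h1, h2, r, this, by simp [h1, h2], by simp [h1, h2]⟩

theorem nextCell_none (f : ℕ) (i : Fin n) (s : LState n m V) (ζ : V)
    (h : s.nextCell f i = none) (t : ℕ) (r : Fin m) (v : V) : s.nextOp f i ζ ≠ .write t r v := by
  rcases next_cases f i s ζ with h1 | ⟨_, _, h1⟩ | ⟨_, _, h1⟩ | ⟨_, _, r, _, h1, _⟩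
  · simp [h1]
  · simp [h1]
  · simp [h1]
  · simp [h1] at h

theorem nextCell_some (f : ℕ) (i : Fin n) (s : LState n m V) (ζ : V) {x : ℕ × Fin m}
    (h : s.nextCell f i = some x) : ¬ s.fixed < s.done ∧ x.1 = s.done + 1 ∧
      s.CanWrite f i x.2 ∧ s.nextOp f i ζ = .write (s.done + 1) x.2 ζ := by
  unfold LState.nextCell at h
  unfold LState.nextOp
  split_ifs at h with h1
  rcases h3 : pick {r | s.CanWrite f i r} with _ | r
  · simp [h3] at h
  · push Not at h1
    have := mem_of_pick h3
    simp only [h3, Option.map_some, Option.some.injEq] at h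
    subst h
    simp only [if_neg (not_lt.2 h1.1), if_neg h1.2]
    exact ⟨not_lt.2 h1.1, trivial, this, trivial⟩

theorem Sound.grows_next {f : ℕ} {p : Fin n} {s : LState n m V} (hs : Sound f p s)
    (inbox : Fin n → Multiset (Packet n m V)) (ζ : V) : Grows s (s.next f p inbox ζ) where
  own := List.prefix_append _ _
  done := by
    rcases next_cases f p s ζ with h | ⟨_, _, h⟩ | ⟨_, _, h⟩ | ⟨_, _, _, _, _, h⟩ <;>
      simp [LState.next, h, LState.doneAfter]
  fixed := by
    rcases next_cases f p s ζ with h | ⟨_, _, h⟩ | ⟨_, _, h⟩ | ⟨_, _, _, _, _, h⟩ <;>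
      simp [LState.next, h, LState.fixedAfter]
    exact hs.fixed_le
  echo := fun _ _ _ h => keep_of_some _ h
  ready := fun _ _ _ h => keep_of_some _ h
  heard := fun _ _ => Set.subset_union_left
  logs := fun _ => List.prefix_append _ _

theorem Sound.next {f : ℕ} {p : Fin n} {s : LState n m V} (hs : Sound f p s)
    (inbox : Fin n → Multiset (Packet n m V)) (ζ : V) : Sound f p (s.next f p inbox ζ) := by
  have g := hs.grows_next inbox ζ
  have hlen : ∀ j, (s.logs j).length ≤ ((s.next f p inbox ζ).logs j).length :=
    fun j => (g.logs j).length_le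
  -- The process obeys the rules by which the others will judge its entry.
  have hvalid : Valid f (fun k x => s.own[k]? = some x) (rel s.logs) p (s.nextEntry f p ζ) := by
    refine ⟨fun k x hx => ⟨fun j => (hs.own_valid k x hx).1 j,
      (hs.lev_le k x hx).trans g.done⟩, fun j k x hx j' => (hs.logs_valid j k x hx).1 j', ?_⟩
    rcases next_cases f p s ζ with h | ⟨h1, h2, h⟩ | ⟨h1, h2, h⟩ | ⟨_, _, r, h1, _, h⟩ <;>
      simp only [LState.nextEntry, h, ValidOp, LState.doneAfter]
    · refine ⟨(hs.complete_iff _).2 ⟨by omega, le_rfl⟩, h2, fun k x hk hx => ?_⟩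
      have := (hs.fix_iff _).1 ⟨k, x, hk, hx⟩
      omega
    · exact ⟨trivial, h2⟩
    · exact h1
  have hown : ∀ {k e}, (s.next f p inbox ζ).own[k]? = some e →
      s.own[k]? = some e ∨ (k = s.own.length ∧ e = s.nextEntry f p ζ) :=
    fun h => getElem?_concat h
  have hnew : (s.next f p inbox ζ).own[s.own.length]? = some (s.nextEntry f p ζ) := by
    simp [LState.next]
  constructor
  · intro i k e h
    rcases keep_eq_some h with h | h
    · exact g.heard _ _ (hs.echo_heard i k e h)
    · exact h
  · intro i k e h
    rcases keep_eq_some h with h | h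
    · exact (hs.ready_cause i k e h).mono g.heard
    · exact h
  · intro i k e h
    exact keep_ne_none _ ⟨e, h⟩
  · intro i k e h
    exact keep_ne_none _ ⟨e, h⟩
  · intro i k e h
    rcases getElem?_concat_toList h with h | ⟨rfl, hp⟩
    · exact (hs.delivered i k e h).mono g.heard
    · exact (mem_of_pick hp).1
  · intro i k e h
    rcases getElem?_concat_toList h with h | ⟨rfl, hp⟩
    · obtain ⟨h1, h2⟩ := hs.logs_valid i k e h
      refine ⟨fun j => (h1 j).trans (hlen j), ?_⟩
      rwa [cut_rel_eq g.logs h1, before_eq (g.logs i) (List.getElem?_eq_some_iff.1 h).1.le]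
    · obtain ⟨h1, h2⟩ := (mem_of_pick hp).2
      refine ⟨fun j => (h1 j).trans (hlen j), ?_⟩
      rwa [cut_rel_eq g.logs h1, before_eq (g.logs i) le_rfl, before_length]
  · intro k e h
    rcases hown h with h | ⟨rfl, rfl⟩
    · obtain ⟨h1, h2⟩ := hs.own_valid k e h
      refine ⟨fun j => (h1 j).trans (hlen j), ?_⟩
      rwa [cut_rel_eq g.logs h1, before_eq g.own (List.getElem?_eq_some_iff.1 h).1.le]
    · refine ⟨hlen, ?_⟩
      rw [cut_rel_eq g.logs (C := (s.nextEntry f p ζ).clock) (fun j => le_rfl),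
        before_eq g.own le_rfl, before_length,
        show (s.nextEntry f p ζ).clock = fun j => (s.logs j).length from rfl, cut_rel_length]
      exact hvalid
  · intro k e h
    rcases hown h with h | ⟨rfl, rfl⟩
    · exact (hs.lev_le k e h).trans g.done
    · exact le_rfl
  · have := hs.fixed_le
    rcases next_cases f p s ζ with h | ⟨_, _, h⟩ | ⟨_, _, h⟩ | ⟨_, _, _, _, _, h⟩ <;>
      simp only [LState.next, h, LState.fixedAfter, LState.doneAfter] <;> omega
  · have := hs.done_le
    rcases next_cases f p s ζ with h | ⟨_, _, h⟩ | ⟨_, _, h⟩ | ⟨_, _, _, _, _, h⟩ <;>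
      simp only [LState.next, h, LState.fixedAfter, LState.doneAfter] <;> omega
  · intro t
    have key : (∃ (k : ℕ) (e : Entry n m V), (s.next f p inbox ζ).own[k]? = some e ∧ e.op = .complete t) ↔
        (∃ (k : ℕ) (e : Entry n m V), s.own[k]? = some e ∧ e.op = .complete t) ∨ s.nextOp f p ζ = .complete t := by
      constructor
      · rintro ⟨k, e, h, he⟩
        rcases hown h with h | ⟨rfl, rfl⟩
        · exact Or.inl ⟨k, e, h, he⟩
        · exact Or.inr he
      · rintro (⟨k, e, h, he⟩ | h)
        · exact ⟨k, e, getElem?_of_prefix g.own h, he⟩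
        · exact ⟨_, _, hnew, h⟩
    rw [key, hs.complete_iff]
    rcases next_cases f p s ζ with h | ⟨_, _, h⟩ | ⟨_, _, h⟩ | ⟨_, _, _, _, _, h⟩ <;>
      simp only [LState.next, h, LState.doneAfter, reduceCtorEq, or_false, Op.complete.injEq]
    omega
  · intro t
    have key : (∃ (k : ℕ) (e : Entry n m V), (s.next f p inbox ζ).own[k]? = some e ∧ e.op = .fix t) ↔
        (∃ (k : ℕ) (e : Entry n m V), s.own[k]? = some e ∧ e.op = .fix t) ∨ s.nextOp f p ζ = .fix t := by
      constructor
      · rintro ⟨k, e, h, he⟩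
        rcases hown h with h | ⟨rfl, rfl⟩
        · exact Or.inl ⟨k, e, h, he⟩
        · exact Or.inr he
      · rintro (⟨k, e, h, he⟩ | h)
        · exact ⟨k, e, getElem?_of_prefix g.own h, he⟩
        · exact ⟨_, _, hnew, h⟩
    have := hs.done_le
    rw [key, hs.fix_iff]
    rcases next_cases f p s ζ with h | ⟨_, _, h⟩ | ⟨_, _, h⟩ | ⟨_, _, _, _, _, h⟩ <;>
      simp only [LState.next, h, LState.fixedAfter, reduceCtorEq, or_false, Op.fix.injEq]
    omega
  · intro k e t r v h he
    have := g.fixed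
    rcases hown h with h | ⟨rfl, rfl⟩
    · exact (hs.write_le k e t r v h he).trans (by omega)
    · rcases next_cases f p s ζ with h | ⟨_, _, h⟩ | ⟨_, _, h⟩ | ⟨h1, _, _, _, _, h⟩ <;>
        simp only [LState.nextEntry, h, reduceCtorEq, Op.write.injEq] at he
      omega

variable {f : ℕ}

/-! ### Quorums -/

theorem many_iff {p : Fin n → Prop} : Many f p ↔ {j | ¬ p j}.ncard ≤ f := by
  have h := Set.ncard_add_ncard_compl {j : Fin n | p j}
  rw [Nat.card_fin] at h
  have : {j : Fin n | p j}ᶜ = {j | ¬ p j} := rfl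
  rw [this] at h
  unfold Many
  omega

/-- Three complements of size at most `f` cannot cover all `n` processes. -/
theorem Many.exists_three (hf : 3 * f < n) {p q r : Fin n → Prop} (hp : Many f p)
    (hq : Many f q) (hr : Many f r) : ∃ z, p z ∧ q z ∧ r z := by
  by_contra! h
  rw [many_iff] at hp hq hr
  have hsub : (Set.univ : Set (Fin n)) ⊆ {j | ¬ p j} ∪ ({j | ¬ q j} ∪ {j | ¬ r j}) := by
    intro z _
    by_cases h1 : p z
    · by_cases h2 : q z
      · exact Or.inr (Or.inr (h z h1 h2))
      · exact Or.inr (Or.inl h2)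
    · exact Or.inl h1
  have h1 := Set.ncard_le_ncard hsub
  have h2 := Set.ncard_union_le {j : Fin n | ¬ p j} ({j | ¬ q j} ∪ {j | ¬ r j})
  have h3 := Set.ncard_union_le {j : Fin n | ¬ q j} {j | ¬ r j}
  rw [Set.ncard_univ, Nat.card_fin] at h1
  omega

theorem Many.exists_of_lt {p q : Fin n → Prop} (hp : Many f p) (hq : f < {z | q z}.ncard) :
    ∃ z, p z ∧ q z := by
  by_contra! h
  rw [many_iff] at hp
  have h1 := Set.ncard_le_ncard (s := {z : Fin n | q z}) (t := {j | ¬ p j})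
    fun z hz hpz => h z hpz hz
  omega

theorem Many.lt_and (hf : 3 * f < n) {p q : Fin n → Prop} (hp : Many f p) (hq : Many f q) :
    f < {z | p z ∧ q z}.ncard := by
  have h0 := Set.ncard_add_ncard_compl {z : Fin n | p z ∧ q z}
  rw [many_iff] at hp hq
  have hsub : {z : Fin n | p z ∧ q z}ᶜ ⊆ {j | ¬ p j} ∪ {j | ¬ q j} := by
    intro z hz
    by_cases h1 : p z
    · exact Or.inr fun h2 => hz ⟨h1, h2⟩
    · exact Or.inl h1
  have h1 := Set.ncard_le_ncard hsub
  have h2 := Set.ncard_union_le {j : Fin n | ¬ p j} {j | ¬ q j}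
  rw [Nat.card_fin] at h0
  omega

/-! ### Executions of the protocol -/

namespace Execution

variable (e : Execution (logProtocol n m V f) f)

noncomputable def loc (τ : ℕ) (p : Fin n) : LState n m V := e.st τ p

noncomputable def outbox (τ : ℕ) (i j : Fin n) : Multiset (Packet n m V) := (e.conf τ).out i j

noncomputable def inbox (τ : ℕ) (i j : Fin n) : Multiset (Packet n m V) := (e.conf τ).inb i j

theorem loc_zero (p : Fin n) : e.loc 0 p = .initial := by
  unfold loc st
  rw [e.conf_zero]
  rfl

theorem bad_mono {τ τ' : ℕ} (h : τ ≤ τ') : (e.conf τ).bad ⊆ (e.conf τ').bad := by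
  induction h with
  | refl => exact subset_rfl
  | @step σ _ ih =>
    refine ih.trans ?_
    have hs := e.conf_succ σ
    cases hev : e.event σ <;> rw [hev] at hs <;> simp only [Step] at hs
    · rw [hs.2]; exact subset_rfl
    · rw [hs.2]; exact subset_rfl
    · obtain ⟨_, _, hs⟩ := hs; rw [hs]
    · rw [hs.2.2]; exact Finset.subset_insert _ _

theorem Good.of_le {e : Execution (logProtocol n m V f) f} {τ τ' : ℕ} {p : Fin n}
    (h : e.Good τ' p) (hτ : τ ≤ τ') : e.Good τ p :=
  fun hp => h (e.bad_mono hτ hp)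

theorem card_bad_le (τ : ℕ) : (e.conf τ).bad.card ≤ f := by
  induction τ with
  | zero => rw [e.conf_zero]; simp
  | succ σ ih =>
    have hs := e.conf_succ σ
    cases hev : e.event σ <;> rw [hev] at hs <;> simp only [Step] at hs
    · rw [hs.2]; exact ih
    · rw [hs.2]; exact ih
    · obtain ⟨_, _, hs⟩ := hs; rw [hs]; exact ih
    · rw [hs.2.2]
      exact (Finset.card_insert_le _ _).trans hs.2.1

/-- Corruption is adaptive, but by some finite time everyone who is ever corrupted has been
corrupted, and the bound `f` applies then. Quorums can thus be intersected with processes that are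
good at all times. -/
theorem many_alwaysGood : Many f e.AlwaysGood := by
  rw [many_iff]
  have h : ∀ i : Fin n, ∃ T, ¬ e.AlwaysGood i → i ∈ (e.conf T).bad := by
    intro i
    by_cases hi : e.AlwaysGood i
    · exact ⟨0, fun h => absurd hi h⟩
    · unfold AlwaysGood Good at hi
      push Not at hi
      obtain ⟨T, hT⟩ := hi
      exact ⟨T, fun _ => hT⟩
  choose T hT using h
  have hsub : {j | ¬ e.AlwaysGood j} ⊆ ((e.conf (Finset.univ.sup T)).bad : Set (Fin n)) :=
    fun i hi => e.bad_mono (Finset.le_sup (Finset.mem_univ i)) (hT i hi)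
  have := Set.ncard_le_ncard hsub
  rw [Set.ncard_coe_finset] at this
  exact this.trans (e.card_bad_le _)

theorem loc_compute {τ : ℕ} {p : Fin n} {ζ : V} (h : e.event τ = .compute p ζ) :
    e.loc (τ + 1) p = (e.loc τ p).next f p (fun j => e.inbox τ j p) ζ := by
  have hs := e.conf_succ τ
  rw [h] at hs
  unfold loc st
  rw [hs.2]
  simp only [Config.afterCompute, Function.update_self]
  rfl

theorem loc_succ {τ : ℕ} {p : Fin n} (hp : e.Good τ p) :
    e.loc (τ + 1) p = e.loc τ p ∨ ∃ ζ, e.event τ = .compute p ζ := by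
  have hs := e.conf_succ τ
  unfold loc st
  cases hev : e.event τ with
  | compute i ζ =>
    rw [hev] at hs
    by_cases hi : p = i
    · subst hi; exact Or.inr ⟨ζ, rfl⟩
    · left; rw [hs.2]; simp only [Config.afterCompute, Function.update_of_ne hi]; rfl
  | byzantine i s ms =>
    rw [hev] at hs
    have hi : p ≠ i := by rintro rfl; exact hp hs.1
    left; rw [hs.2]; simp only [Config.afterCompute, Function.update_of_ne hi]; rfl
  | deliver i j x =>
    rw [hev] at hs
    obtain ⟨_, _, hs⟩ := hs
    left; rw [hs]
  | corrupt i =>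
    rw [hev] at hs
    left; rw [hs.2.2]

theorem sound (hf : 3 * f < n) {τ : ℕ} {p : Fin n} (hp : e.Good τ p) :
    Sound f p (e.loc τ p) := by
  induction τ with
  | zero => rw [loc_zero]; exact sound_initial f (by omega) p
  | succ τ ih =>
    have ih := ih (hp.of_le τ.le_succ)
    rcases e.loc_succ (hp.of_le τ.le_succ) with h | ⟨ζ, h⟩
    · rw [h]; exact ih
    · rw [e.loc_compute h]; exact ih.next _ _

theorem grows (hf : 3 * f < n) {τ τ' : ℕ} (hτ : τ ≤ τ') {p : Fin n} (hp : e.Good τ' p) :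
    Grows (e.loc τ p) (e.loc τ' p) := by
  induction hτ with
  | refl => exact Grows.rfl
  | @step σ _ ih =>
    have hσ := hp.of_le σ.le_succ
    refine (ih hσ).trans ?_
    rcases e.loc_succ hσ with h | ⟨ζ, h⟩
    · rw [h]; exact Grows.rfl
    · rw [e.loc_compute h]; exact (e.sound hf hσ).grows_next _ _

theorem mem_outbox_succ {τ : ℕ} {z p : Fin n} (hz : e.Good τ z) {x : Packet n m V}
    (hx : x ∈ e.outbox (τ + 1) z p) : x ∈ e.outbox τ z p ∨ x = (e.loc (τ + 1) z).said := by
  have hs := e.conf_succ τ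
  unfold outbox at *
  cases hev : e.event τ with
  | compute i ζ =>
    by_cases hi : z = i
    · subst hi
      rw [e.loc_compute hev]
      rw [hev] at hs
      rw [hs.2] at hx
      simp only [Config.afterCompute, Function.update_self] at hx
      exact (Multiset.mem_add.1 hx).imp id fun hx => Multiset.mem_singleton.1 hx
    · rw [hev] at hs
      rw [hs.2] at hx
      simp only [Config.afterCompute, Function.update_of_ne hi] at hx
      exact Or.inl hx
  | byzantine i s ms =>
    rw [hev] at hs
    have hi : z ≠ i := by rintro rfl; exact hz hs.1
    rw [hs.2] at hx
    simp only [Config.afterCompute, Function.update_of_ne hi] at hx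
    exact Or.inl hx
  | deliver i j y =>
    rw [hev] at hs
    obtain ⟨rest, hr, hs⟩ := hs
    rw [hs] at hx
    left
    by_cases hi : z = i
    · subst hi
      by_cases hj : p = j
      · subst hj
        simp only [Function.update_self] at hx
        rw [hr]; exact Multiset.mem_cons_of_mem hx
      · simpa [Function.update_of_ne hj] using hx
    · simpa [Function.update_of_ne hi] using hx
  | corrupt i =>
    rw [hev] at hs
    rw [hs.2.2] at hx
    exact Or.inl hx

theorem mem_inbox_succ {τ : ℕ} {z p : Fin n} {x : Packet n m V}
    (hx : x ∈ e.inbox (τ + 1) z p) : x ∈ e.inbox τ z p ∨ x ∈ e.outbox τ z p := by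
  have hs := e.conf_succ τ
  unfold outbox inbox at *
  cases hev : e.event τ with
  | compute i ζ =>
    rw [hev] at hs
    rw [hs.2] at hx
    by_cases hi : p = i
    · subst hi
      simp only [Config.afterCompute, Function.update_self] at hx
      exact absurd hx (Multiset.notMem_zero x)
    · simp only [Config.afterCompute, Function.update_of_ne hi] at hx
      exact Or.inl hx
  | byzantine i s ms =>
    rw [hev] at hs
    rw [hs.2] at hx
    by_cases hi : p = i
    · subst hi
      simp only [Config.afterCompute, Function.update_self] at hx
      exact absurd hx (Multiset.notMem_zero x)
    · simp only [Config.afterCompute, Function.update_of_ne hi] at hx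
      exact Or.inl hx
  | deliver i j y =>
    rw [hev] at hs
    obtain ⟨rest, hr, hs⟩ := hs
    rw [hs] at hx
    by_cases hi : z = i
    · subst hi
      by_cases hj : p = j
      · subst hj
        simp only [Function.update_self] at hx
        rcases Multiset.mem_cons.1 hx with rfl | hx
        · right; rw [hr]; exact Multiset.mem_cons_self _ _
        · exact Or.inl hx
      · left; simpa [Function.update_of_ne hj] using hx
    · left; simpa [Function.update_of_ne hi] using hx
  | corrupt i =>
    rw [hev] at hs
    rw [hs.2.2] at hx
    exact Or.inl hx

theorem outbox_compute {τ : ℕ} {i : Fin n} {ζ : V} (h : e.event τ = .compute i ζ) (j : Fin n) :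
    (e.loc (τ + 1) i).said ∈ e.outbox (τ + 1) i j := by
  rw [e.loc_compute h]
  have hs := e.conf_succ τ
  rw [h] at hs
  unfold outbox
  rw [hs.2]
  simp only [Config.afterCompute, Function.update_self]
  exact Multiset.mem_add.2 (Or.inr (Multiset.mem_singleton_self _))

theorem inbox_deliver {τ : ℕ} {i j : Fin n} {x : Packet n m V}
    (h : e.event τ = .deliver i j x) : x ∈ e.inbox (τ + 1) i j := by
  have hs := e.conf_succ τ
  rw [h] at hs
  obtain ⟨rest, hr, hs⟩ := hs
  unfold inbox
  rw [hs]
  simp only [Function.update_self]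
  exact Multiset.mem_cons_self _ _

theorem inbox_keep {τ : ℕ} {i j : Fin n} (hj : e.Good τ j) (hc : ∀ ζ, e.event τ ≠ .compute j ζ)
    {x : Packet n m V} (hx : x ∈ e.inbox τ i j) : x ∈ e.inbox (τ + 1) i j := by
  have hs := e.conf_succ τ
  unfold inbox at *
  cases hev : e.event τ with
  | compute k ζ =>
    rw [hev] at hs hc
    have hk : j ≠ k := by rintro rfl; exact hc ζ rfl
    rw [hs.2]
    simpa [Config.afterCompute, Function.update_of_ne hk] using hx
  | byzantine k s ms =>
    rw [hev] at hs
    have hk : j ≠ k := by rintro rfl; exact hj hs.1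
    rw [hs.2]
    simpa [Config.afterCompute, Function.update_of_ne hk] using hx
  | deliver k l y =>
    rw [hev] at hs
    obtain ⟨rest, hr, hs⟩ := hs
    rw [hs]
    by_cases hi : i = k
    · subst hi
      by_cases hj : j = l
      · subst hj
        simp only [Function.update_self]
        exact Multiset.mem_cons_of_mem hx
      · simpa [Function.update_of_ne hj] using hx
    · simpa [Function.update_of_ne hi] using hx
  | corrupt k =>
    rw [hev] at hs
    rw [hs.2.2]
    exact hx

/-! ### Reliable broadcast: consistency -/

/-- Messages of a good process are true. -/
theorem honest (hf : 3 * f < n) {τ : ℕ} {z p : Fin n} (hz : e.Good τ z) :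
    (∀ M, M ∈ e.outbox τ z p ∨ M ∈ e.inbox τ z p → ∀ g x, M g = some x →
      (e.loc τ z).said g = some x) ∧
    (e.Good τ p → ∀ g x, x ∈ (e.loc τ p).heard z g → (e.loc τ z).said g = some x) := by
  induction τ with
  | zero =>
    refine ⟨fun M hM => ?_, fun _ g x hx => ?_⟩
    · unfold outbox inbox at hM
      rw [e.conf_zero] at hM
      exact absurd hM (by rintro (h | h) <;> exact Multiset.notMem_zero M h)
    · rw [loc_zero] at hx
      exact absurd hx (Set.notMem_empty x)
  | succ τ ih =>
    have hz' := hz.of_le τ.le_succ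
    obtain ⟨ih1, ih2⟩ := ih hz'
    have g0 := e.grows hf τ.le_succ hz
    refine ⟨fun M hM g x hx => ?_, fun hp g x hx => ?_⟩
    · have : M ∈ e.outbox τ z p ∨ M ∈ e.inbox τ z p ∨ M = (e.loc (τ + 1) z).said := by
        rcases hM with hM | hM
        · rcases e.mem_outbox_succ hz' hM with h | h
          · exact Or.inl h
          · exact Or.inr (Or.inr h)
        · rcases e.mem_inbox_succ hM with h | h
          · exact Or.inr (Or.inl h)
          · exact Or.inl h
      rcases this with h | h | rfl
      · exact g0.said (ih1 M (Or.inl h) g x hx)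
      · exact g0.said (ih1 M (Or.inr h) g x hx)
      · exact hx
    · have hp' := hp.of_le τ.le_succ
      rcases e.loc_succ hp' with h | ⟨ζ, h⟩
      · rw [h] at hx
        exact g0.said (ih2 hp' g x hx)
      · rw [e.loc_compute h] at hx
        rcases hx with hx | ⟨M, hM, hx⟩
        · exact g0.said (ih2 hp' g x hx)
        · exact g0.said (ih1 M (Or.inr hM) g x hx)

theorem said_of_heard (hf : 3 * f < n) {τ : ℕ} {z p : Fin n} (hz : e.Good τ z)
    (hp : e.Good τ p) {g : Tag n} {x : Entry n m V} (hx : x ∈ (e.loc τ p).heard z g) :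
    (e.loc τ z).said g = some x :=
  (e.honest hf hz).2 hp g x hx

/-- The entry `x` has been echoed widely as the `k`-th one of `i`. -/
def EchoQuorum (τ : ℕ) (i : Fin n) (k : ℕ) (x : Entry n m V) : Prop :=
  ∃ z, e.AlwaysGood z ∧ Many f fun y => x ∈ (e.loc τ z).heard y (.echo i k)

theorem EchoQuorum.mono (hf : 3 * f < n) {e : Execution (logProtocol n m V f) f} {τ τ' : ℕ}
    (hτ : τ ≤ τ') {i : Fin n} {k : ℕ} {x : Entry n m V} (h : e.EchoQuorum τ i k x) :
    e.EchoQuorum τ' i k x := by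
  obtain ⟨z, hz, h⟩ := h
  exact ⟨z, hz, h.mono fun y hy => (e.grows hf hτ (hz τ')).heard _ _ hy⟩

/-- Moved to a common time, the two quorums share a never-corrupted echoer, which fills its echo
slot only once. -/
theorem EchoQuorum.eq (hf : 3 * f < n) {e : Execution (logProtocol n m V f) f} {τ τ' : ℕ}
    {i : Fin n} {k : ℕ} {x x' : Entry n m V} (h : e.EchoQuorum τ i k x)
    (h' : e.EchoQuorum τ' i k x') : x = x' := by
  obtain ⟨z, hz, h⟩ := h.mono hf (le_max_left τ τ')
  obtain ⟨z', hz', h'⟩ := h'.mono hf (le_max_right τ τ')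
  obtain ⟨y, hy, h1, h2⟩ := e.many_alwaysGood.exists_three hf h h'
  have h1 := e.said_of_heard hf (hy _) (hz _) h1
  have h2 := e.said_of_heard hf (hy _) (hz' _) h2
  rw [h1] at h2
  exact Option.some.inj h2

/-- Amplification cannot start by itself: among more than `f` confirmers there is a never-corrupted
one that confirmed earlier, so induction on time leads back to an echo quorum. -/
theorem echoQuorum_of_ready (hf : 3 * f < n) {τ : ℕ} {z : Fin n} (hz : e.AlwaysGood z) {i : Fin n}
    {k : ℕ} {x : Entry n m V} (h : (e.loc τ z).ready i k = some x) :
    e.EchoQuorum τ i k x := by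
  induction τ generalizing z with
  | zero => rw [loc_zero] at h; simp [LState.initial] at h
  | succ τ ih =>
    rcases e.loc_succ (hz τ) with h' | ⟨ζ, h'⟩
    · rw [h'] at h
      exact (ih hz h).mono hf τ.le_succ
    · have h0 := h
      rw [e.loc_compute h'] at h
      rcases keep_eq_some h with h | h
      · exact (ih hz h).mono hf τ.le_succ
      · rcases h with h | h
        · refine ⟨z, hz, ?_⟩
          rw [e.loc_compute h']
          exact h
        · obtain ⟨y, hy, hx⟩ := e.many_alwaysGood.exists_of_lt h
          refine (ih hy (?_ : (e.loc τ y).said (.ready i k) = some x)).mono hf τ.le_succ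
          rcases hx with hx | ⟨M, hM, hx⟩
          · exact e.said_of_heard hf (hy τ) (hz τ) hx
          · exact (e.honest hf (hy τ)).1 M (Or.inr hM) _ _ hx

theorem echoQuorum_of_delivered (hf : 3 * f < n) {τ : ℕ} {p : Fin n} (hp : e.Good τ p)
    {i : Fin n} {k : ℕ} {x : Entry n m V} (h : Delivered f (e.loc τ p).heard i k x) :
    e.EchoQuorum τ i k x := by
  obtain ⟨y, hy, h1, _⟩ := e.many_alwaysGood.exists_three hf h h
  exact e.echoQuorum_of_ready hf hy (e.said_of_heard hf (hy τ) hp h1)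

/-- Some good process has by time `τ` accepted `x` as the `k`-th entry of `i`. -/
def AcceptedBy (τ : ℕ) : Entries n m V :=
  fun i k x => ∃ σ ≤ τ, ∃ p, e.Good σ p ∧ ((e.loc σ p).logs i)[k]? = some x

/-- Some good process has at some time accepted `x` as the `k`-th entry of `i`. -/
def AcceptedEver : Entries n m V := fun i k x => ∃ τ, e.AcceptedBy τ i k x

theorem echoQuorum_of_acceptedBy (hf : 3 * f < n) {τ : ℕ} {i : Fin n} {k : ℕ}
    {x : Entry n m V} (h : e.AcceptedBy τ i k x) : e.EchoQuorum τ i k x := by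
  obtain ⟨σ, hσ, p, hp, h⟩ := h
  exact (e.echoQuorum_of_delivered hf hp ((e.sound hf hp).delivered i k x h)).mono hf hσ

theorem acceptedEver_unique (hf : 3 * f < n) {i : Fin n} {k : ℕ} {x x' : Entry n m V}
    (h : e.AcceptedEver i k x) (h' : e.AcceptedEver i k x') : x = x' := by
  obtain ⟨τ, h⟩ := h
  obtain ⟨τ', h'⟩ := h'
  exact (e.echoQuorum_of_acceptedBy hf h).eq hf (e.echoQuorum_of_acceptedBy hf h')

theorem acceptedEver_of_log {τ : ℕ} {p : Fin n} (hp : e.Good τ p) {i : Fin n} {k : ℕ}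
    {x : Entry n m V} (h : ((e.loc τ p).logs i)[k]? = some x) : e.AcceptedEver i k x :=
  ⟨τ, τ, le_rfl, p, hp, h⟩

theorem log_of_acceptedEver (hf : 3 * f < n) {τ : ℕ} {p : Fin n} (hp : e.Good τ p) {i : Fin n}
    {k : ℕ} {x : Entry n m V} (h : e.AcceptedEver i k x) (hk : k < ((e.loc τ p).logs i).length) :
    ((e.loc τ p).logs i)[k]? = some x := by
  rw [e.acceptedEver_unique hf h (e.acceptedEver_of_log hp (List.getElem?_eq_getElem hk)),
    List.getElem?_eq_getElem hk]

/-- By uniqueness of accepted entries, what a good process computes from its logs below a covered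
clock depends on the clock alone. -/
theorem cut_log (hf : 3 * f < n) {τ : ℕ} {p : Fin n} (hp : e.Good τ p) {C : Fin n → ℕ}
    (hC : ∀ j, C j ≤ ((e.loc τ p).logs j).length) :
    cut (rel (e.loc τ p).logs) C = cut e.AcceptedEver C := by
  funext j k x
  simp only [cut, rel, eq_iff_iff]
  exact and_congr_right fun hk => ⟨fun h => e.acceptedEver_of_log hp h,
    fun h => e.log_of_acceptedEver hf hp h (lt_of_lt_of_le hk (hC j))⟩

theorem own_of_echo (hf : 3 * f < n) {τ : ℕ} {z i : Fin n} (hz : e.Good τ z) (hi : e.Good τ i)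
    {k : ℕ} {x : Entry n m V} (h : (e.loc τ z).echo i k = some x) :
    (e.loc τ i).own[k]? = some x :=
  e.said_of_heard hf hi hz ((e.sound hf hz).echo_heard i k x h)

theorem own_of_echoQuorum (hf : 3 * f < n) {τ : ℕ} {i : Fin n} (hi : e.Good τ i) {k : ℕ}
    {x : Entry n m V} (h : e.EchoQuorum τ i k x) : (e.loc τ i).own[k]? = some x := by
  obtain ⟨z, hz, h⟩ := h
  obtain ⟨y, hy, h1, _⟩ := e.many_alwaysGood.exists_three hf h h
  exact e.own_of_echo hf (hy τ) hi (e.said_of_heard hf (hy τ) (hz τ) h1)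

/-- What is accepted for a good process has been issued by it. -/
theorem own_of_acceptedBy (hf : 3 * f < n) {τ : ℕ} {i : Fin n} (hi : e.Good τ i) {k : ℕ}
    {x : Entry n m V} (h : e.AcceptedBy τ i k x) : (e.loc τ i).own[k]? = some x :=
  e.own_of_echoQuorum hf hi (e.echoQuorum_of_acceptedBy hf h)

end Execution

/-! ### Collections of valid entries -/

/-- `E` holds at most one entry at each position, and all of them are valid. -/
structure Coherent (f : ℕ) (E : Entries n m V) : Prop where
  unique : ∀ i k x x', E i k x → E i k x' → x = x'
  valid : ∀ i k x, E i k x → Valid f (fun k' y => k' < k ∧ E i k' y) (cut E x.clock) i x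

/-- `h` is the history written in the entries `R`. -/
def IsHist (h : History m n V) (R : Entries n m V) : Prop :=
  ∀ t r i v, h t r i = some v ↔ ∃ k x, R i k x ∧ x.op = .write t r v

/-- A process may fix its view of the matrices `1, …, t` when it knows the entries below `C`. -/
structure FixCut (f : ℕ) (E : Entries n m V) (C : Fin n → ℕ) (t : ℕ) : Prop where
  past_le : ∀ j k x, cut E C j k x → x.clock ≤ C
  reported : Reported f (cut E C) t
  closed : ∃ C', Closed f (cut E C') t

/-- Legal writes of one author are strictly increasing in lexicographic order. -/
theorem Coherent.write_unique {E : Entries n m V} (hE : Coherent f E) {i : Fin n} {k k' : ℕ}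
    {x x' : Entry n m V} {t : ℕ} {r : Fin m} {v v' : V} (h : E i k x) (h' : E i k' x')
    (hx : x.op = .write t r v) (hx' : x'.op = .write t r v') : k = k' ∧ v = v' := by
  have key : ∀ {k k' : ℕ} {x x' : Entry n m V} {v v' : V}, E i k x → E i k' x' →
      x.op = .write t r v → x'.op = .write t r v' → ¬ k < k' := by
    intro k k' x x' v v' h h' hx hx' hk
    have hv := (hE.valid i k' x' h').op
    rw [hx'] at hv
    rcases hv.lex k x t r v ⟨hk, h⟩ hx with h1 | ⟨_, h1⟩
    · exact lt_irrefl _ h1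
    · exact lt_irrefl _ h1
  have hk : k = k' := le_antisymm (not_lt.1 (key h' h hx' hx)) (not_lt.1 (key h h' hx hx'))
  subst hk
  have := hE.unique _ _ _ _ h h'
  subst this
  rw [hx] at hx'
  cases hx'
  exact ⟨rfl, rfl⟩

theorem isHist_hist {E R : Entries n m V} (hE : Coherent f E) (hR : ∀ i k x, R i k x → E i k x) :
    IsHist (hist R) R := by
  intro t r i v
  unfold hist
  rw [pick_eq_some]
  · rfl
  · rintro v ⟨k, x, h, hx⟩ v' ⟨k', x', h', hx'⟩
    exact (hE.write_unique (hR _ _ _ h) (hR _ _ _ h') hx hx').2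

/-- The key synchronisation step. An author in both the acknowledging and the reporting quorum
acknowledged before completing, so its completion entry, which lies below `C`, has a clock covering
the acknowledged entry. The author may be corrupted; only the legality of its log matters. -/
theorem Coherent.clock_lt {E : Entries n m V} (hE : Coherent f E) (hf : 3 * f < n)
    {C C' : Fin n → ℕ} {t s k : ℕ} {j : Fin n} (hC : FixCut f E C t) (hst : s ≤ t)
    (hA : Acked f (cut E C') j k s) : k < C j := by
  obtain ⟨y, ⟨l, x, ⟨_, hx⟩, hk, hlev⟩, ⟨l', x', hx', hop⟩, _⟩ :=
    hA.exists_three hf hC.reported hC.reported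
  have hv := hE.valid y l' x' hx'.2
  have hlev' : x'.lev = t := by
    have := hv.op
    rw [hop] at this
    exact this.1
  -- Levels do not decrease along the log of `y`, and `x` has level below `s ≤ t` while `x'` has
  -- level `t`.
  have hll : l < l' := by
    by_contra hll
    rcases (not_lt.1 hll).lt_or_eq with h | h
    · have := ((hE.valid y l x hx).own_le l' x' ⟨h, hx'.2⟩).2
      omega
    · subst h
      have := hE.unique _ _ _ _ hx hx'.2
      subst this
      omega
  exact lt_of_lt_of_le hk (((hv.own_le l x ⟨hll, hx⟩).1 j).trans (hC.past_le _ _ _ hx' j))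

/-- A write that is followed by another one of the same author had to be acknowledged first, so
`clock_lt` puts it into the view. A cell missing from the view is therefore the last one written. -/
theorem Coherent.agreesUpToLast {E F : Entries n m V} (hE : Coherent f E) (hf : 3 * f < n)
    {C : Fin n → ℕ} {t : ℕ} (hC : FixCut f E C t) {h B : History m n V}
    (hh : IsHist h (cut E C)) (hB : IsHist B F) (hFE : ∀ i k x, F i k x → E i k x)
    (hCF : ∀ i k x, cut E C i k x → F i k x) : AgreesUpToLast B t h := by
  intro t' ht1 htt r i
  rcases hhv : h t' r i with _ | v
  · rcases hBv : B t' r i with _ | v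
    · simp
    · suffices IsLast B t i t' r from ⟨fun hn => absurd this hn, fun _ => Or.inr rfl⟩
      refine ⟨ht1, htt, by simp [hBv], fun t'' r' _ ht'' hne => ?_⟩
      obtain ⟨w, hw⟩ := Option.ne_none_iff_exists'.1 hne
      obtain ⟨k, x, hx, hxo⟩ := (hB _ _ _ _).1 hBv
      obtain ⟨k', x', hx', hxo'⟩ := (hB _ _ _ _).1 hw
      have hxE := hFE _ _ _ hx
      have hxE' := hFE _ _ _ hx'
      -- If the other write came later in the log, the missing one was acknowledged and would be
      -- visible; if earlier, the lexicographic rule places its cell before.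
      rcases lt_trichotomy k k' with hk | hk | hk
      · have hv := (hE.valid _ _ _ hxE').op
        rw [hxo'] at hv
        have hA := hv.acked k x ⟨hk, hxE⟩ (by simp [hxo])
        have hlt := hE.clock_lt hf hC ht'' hA
        have := (hh t' r i v).2 ⟨k, x, ⟨hlt, hxE⟩, hxo⟩
        rw [hhv] at this
        cases this
      · subst hk
        have := hE.unique _ _ _ _ hxE hxE'
        subst this
        rw [hxo] at hxo'
        cases hxo'
        exact Or.inr ⟨rfl, le_rfl⟩
      · have hv := (hE.valid _ _ _ hxE).op
        rw [hxo] at hv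
        exact (hv.lex k' x' _ _ _ ⟨hk, hxE'⟩ hxo').imp_right fun h => ⟨h.1, h.2.le⟩
  · obtain ⟨k, x, hx, hxo⟩ := (hh _ _ _ _).1 hhv
    have := (hB _ _ _ _).2 ⟨k, x, hCF _ _ _ hx, hxo⟩
    simp [this]

/-- The columns found complete by one process are full in all views. -/
theorem Coherent.common_full {E : Entries n m V} (hE : Coherent f E) (hf : 3 * f < n)
    {C : Fin n → ℕ} {t : ℕ} (hC : FixCut f E C t) :
    Many f fun j => ∀ D, FixCut f E D t → ∀ h, IsHist h (cut E D) → ∀ r, h t r j ≠ none := by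
  obtain ⟨C', hC'⟩ := hC.closed
  refine hC'.mono fun j hj D hD h hh r => ?_
  obtain ⟨k, x, v, hx, hxo, hA⟩ := hj r
  rw [(hh t r j v).2 ⟨k, x, ⟨hE.clock_lt hf hD le_rfl hA, hx.2⟩, hxo⟩]
  simp

/-! ### Counting disagreements -/

theorem agreesUpToLast_self (B : History m n V) (t : ℕ) : AgreesUpToLast B t B :=
  fun _ _ _ _ _ => ⟨fun _ => rfl, fun _ => Or.inl rfl⟩

theorem AgreesUpToLast.ne_none {B h : History m n V} {t : ℕ} (H : AgreesUpToLast B t h) {t' : ℕ}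
    (h1 : 1 ≤ t') (h2 : t' ≤ t) {r : Fin m} {i : Fin n} (hne : h t' r i ≠ none) :
    h t' r i = B t' r i := by
  by_cases hl : IsLast B t i t' r
  · exact ((H t' h1 h2 r i).2 hl).resolve_right hne
  · exact (H t' h1 h2 r i).1 hl

theorem IsLast.unique {B : History m n V} {t : ℕ} {i : Fin n} {t₁ t₂ : ℕ} {r₁ r₂ : Fin m}
    (h₁ : IsLast B t i t₁ r₁) (h₂ : IsLast B t i t₂ r₂) : t₁ = t₂ ∧ r₁ = r₂ := by
  have a := h₁.2.2.2 t₂ r₂ h₂.1 h₂.2.1 h₂.2.2.1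
  have b := h₂.2.2.2 t₁ r₁ h₁.1 h₁.2.1 h₁.2.2.1
  have : t₁ = t₂ := by omega
  subst this
  exact ⟨rfl, le_antisymm (b.resolve_left (lt_irrefl _)).2 (a.resolve_left (lt_irrefl _)).2⟩

/-- A disagreement sits at the last written cell of its column, so the column determines it. If the
column is full in both histories, its last cell is in matrix `t`, where both already show the true
value. -/
theorem encard_disagreements_le {B h h' : History m n V} {t : ℕ} (ht : 1 ≤ t)
    (H : AgreesUpToLast B t h) (H' : AgreesUpToLast B t h')
    (hfull : Many f fun j => ∀ r, h t r j ≠ none ∧ h' t r j ≠ none) :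
    (disagreements t h h').encard ≤ f := by
  have hlast : ∀ x ∈ disagreements t h h', IsLast B t x.2.2 x.1 x.2.1 := by
    rintro ⟨t', r, j⟩ ⟨h1, h2, h3⟩
    by_contra hl
    exact h3 (((H t' h1 h2 r j).1 hl).trans ((H' t' h1 h2 r j).1 hl).symm)
  rw [many_iff] at hfull
  refine le_trans (Set.encard_le_encard_of_injOn (f := fun x => x.2.2)
    (t := {j | ¬ ∀ r, h t r j ≠ none ∧ h' t r j ≠ none}) ?_ ?_) ?_
  · rintro ⟨t', r, j⟩ hx hj
    have hl := hlast _ hx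
    obtain ⟨h1, h2, h3⟩ := hx
    -- The bottom row exists because `r` is a row; its being written forces the last cell of the
    -- column into matrix `t`.
    have hm : m - 1 < m := by have := r.2; omega
    have hB : B t ⟨m - 1, hm⟩ j ≠ none := by
      rw [← H.ne_none ht le_rfl (hj ⟨m - 1, hm⟩).1]
      exact (hj _).1
    have := hl.2.2.2 t ⟨m - 1, hm⟩ ht le_rfl hB
    have htt : t' = t := by
      dsimp only at h2 this
      omega
    subst htt
    exact h3 ((H.ne_none ht le_rfl (hj r).1).trans (H'.ne_none ht le_rfl (hj r).2).symm)
  · intro x h₁ y h₂ hxy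
    dsimp only at hxy
    have hy := hlast y h₂
    rw [← hxy] at hy
    obtain ⟨a, b⟩ := (hlast x h₁).unique hy
    exact Prod.ext a (Prod.ext b hxy)
  · rw [← (Set.toFinite _).cast_ncard_eq]
    exact_mod_cast hfull

/-- The previous entries `O` are kept general to cover both accepted logs and a process's own log,
whose latest entries may not yet be accepted by anyone. -/
theorem fixCut_of_valid {E : Entries n m V} {O : ℕ → Entry n m V → Prop} {i : Fin n}
    {x : Entry n m V} {t : ℕ} (hx : Valid f O (cut E x.clock) i x) (ho : x.op = .fix t)
    (hO : ∀ k y, O k y → y.op = .complete t → Closed f (cut E y.clock) t) :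
    FixCut f E x.clock t := by
  have h := hx.op
  rw [ho] at h
  obtain ⟨⟨k, y, hy, hyo⟩, h2, _⟩ := h
  exact ⟨hx.past_le, h2, y.clock, hO k y hy hyo⟩

theorem closed_of_valid {E : Entries n m V} {O : ℕ → Entry n m V → Prop} {i : Fin n}
    {x : Entry n m V} {t : ℕ} (hx : Valid f O (cut E x.clock) i x) (ho : x.op = .complete t) :
    Closed f (cut E x.clock) t := by
  have h := hx.op
  rw [ho] at h
  exact h.2

theorem Coherent.fixCut {E : Entries n m V} (hE : Coherent f E) {i : Fin n} {k : ℕ}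
    {x : Entry n m V} {t : ℕ} (hx : E i k x) (ho : x.op = .fix t) : FixCut f E x.clock t :=
  fixCut_of_valid (hE.valid i k x hx) ho fun k' y hy hyo =>
    closed_of_valid (hE.valid i k' y hy.2) hyo

theorem Coherent.fix_unique {E : Entries n m V} (hE : Coherent f E) {i : Fin n} {k k' : ℕ}
    {x x' : Entry n m V} {t : ℕ} (h : E i k x) (h' : E i k' x')
    (hx : x.op = .fix t) (hx' : x'.op = .fix t) : x = x' := by
  have key : ∀ {k k' : ℕ} {x x' : Entry n m V}, E i k x → E i k' x' →
      x.op = .fix t → x'.op = .fix t → ¬ k < k' := by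
    intro k k' x x' h h' hx hx' hk
    have hv := (hE.valid i k' x' h').op
    rw [hx'] at hv
    exact hv.2.2 k x ⟨hk, h⟩ hx
  have hk : k = k' := le_antisymm (not_lt.1 (key h' h hx' hx)) (not_lt.1 (key h h' hx hx'))
  subst hk
  exact hE.unique _ _ _ _ h h'

/-! ### Safety -/

theorem Sound.own_write_unique {p : Fin n} {s : LState n m V} (hs : Sound f p s) {k k' : ℕ}
    {x x' : Entry n m V} {t : ℕ} {r : Fin m} {v v' : V} (h : s.own[k]? = some x)
    (h' : s.own[k']? = some x') (hx : x.op = .write t r v) (hx' : x'.op = .write t r v') :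
    v = v' := by
  have key : ∀ {k k' : ℕ} {x x' : Entry n m V} {v v' : V}, s.own[k]? = some x →
      s.own[k']? = some x' → x.op = .write t r v → x'.op = .write t r v' → ¬ k < k' := by
    intro k k' x x' v v' h h' hx hx' hk
    have hv := (hs.own_valid k' x' h').2.op
    rw [hx'] at hv
    rcases hv.lex k x t r v ⟨hk, h⟩ hx with h1 | ⟨_, h1⟩
    · exact lt_irrefl _ h1
    · exact lt_irrefl _ h1
  have hk : k = k' := le_antisymm (not_lt.1 (key h' h hx' hx)) (not_lt.1 (key h h' hx hx'))
  subst hk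
  rw [h] at h'
  cases h'
  rw [hx] at hx'
  cases hx'
  rfl

theorem Sound.own_fix_unique {p : Fin n} {s : LState n m V} (hs : Sound f p s) {k k' : ℕ}
    {x x' : Entry n m V} {t : ℕ} (h : s.own[k]? = some x)
    (h' : s.own[k']? = some x') (hx : x.op = .fix t) (hx' : x'.op = .fix t) :
    x = x' := by
  have key : ∀ {k k' : ℕ} {x x' : Entry n m V}, s.own[k]? = some x →
      s.own[k']? = some x' → x.op = .fix t → x'.op = .fix t → ¬ k < k' := by
    intro k k' x x' h h' hx hx' hk
    have hv := (hs.own_valid k' x' h').2.op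
    rw [hx'] at hv
    exact hv.2.2 k x ⟨hk, h⟩ hx
  have hk : k = k' := le_antisymm (not_lt.1 (key h' h hx' hx)) (not_lt.1 (key h h' hx hx'))
  subst hk
  rw [h] at h'
  exact Option.some.inj h'

namespace Execution

variable (e : Execution (logProtocol n m V f) f)

/-- Each entry was checked against the logs of one good process; `cut_log` turns this into legality
relative to the global collection. -/
theorem coherent (hf : 3 * f < n) : Coherent f e.AcceptedEver where
  unique := fun _ _ _ _ h h' => e.acceptedEver_unique hf h h'
  valid := by
    rintro i k x ⟨τ, σ, _, p, hp, hx⟩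
    obtain ⟨hlen, hv⟩ := (e.sound hf hp).logs_valid i k x hx
    rw [e.cut_log hf hp hlen] at hv
    have : before ((e.loc σ p).logs i) k = fun k' y => k' < k ∧ e.AcceptedEver i k' y := by
      funext k' y
      simp only [before, eq_iff_iff]
      exact and_congr_right fun hk => ⟨fun h => e.acceptedEver_of_log hp h,
        fun h => e.log_of_acceptedEver hf hp h
          (hk.trans (List.getElem?_eq_some_iff.1 hx).1)⟩
    rwa [this] at hv

theorem own_valid (hf : 3 * f < n) {τ : ℕ} {p : Fin n} (hp : e.Good τ p) {k : ℕ}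
    {x : Entry n m V} (hx : (e.loc τ p).own[k]? = some x) :
    Valid f (before (e.loc τ p).own k) (cut e.AcceptedEver x.clock) p x := by
  obtain ⟨hlen, hv⟩ := (e.sound hf hp).own_valid k x hx
  rwa [e.cut_log hf hp hlen] at hv

theorem own_fixCut (hf : 3 * f < n) {τ : ℕ} {p : Fin n} (hp : e.Good τ p) {k t : ℕ}
    {x : Entry n m V} (hx : (e.loc τ p).own[k]? = some x) (ho : x.op = .fix t) :
    FixCut f e.AcceptedEver x.clock t :=
  fixCut_of_valid (e.own_valid hf hp hx) ho fun _ _ hy hyo =>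
    closed_of_valid (e.own_valid hf hp hy.2) hyo

theorem acceptedBy_of_cut (hf : 3 * f < n) {σ τ : ℕ} (hτ : σ ≤ τ) {p : Fin n} (hp : e.Good σ p)
    {C : Fin n → ℕ} (hC : ∀ j, C j ≤ ((e.loc σ p).logs j).length) {i : Fin n} {k : ℕ}
    {x : Entry n m V} (hx : cut e.AcceptedEver C i k x) : e.AcceptedBy τ i k x := by
  rw [← e.cut_log hf hp hC] at hx
  exact ⟨σ, hτ, p, hp, hx.2⟩

theorem view_eq_some (hf : 3 * f < n) {τ : ℕ} {p : Fin n} (hp : e.Good τ p) {t : ℕ}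
    {h : History m n V} : (logProtocol n m V f).view (e.st τ p) t = some h ↔
      ∃ (k : ℕ) (x : Entry n m V), (e.loc τ p).own[k]? = some x ∧ x.op = .fix t ∧
        h = hist (cut e.AcceptedEver x.clock) := by
  have hs := e.sound hf hp
  refine Iff.trans (pick_eq_some ?_) (exists₂_congr fun k x => and_congr_right fun hx => ?_)
  · rintro h ⟨k, x, hx, ho, rfl⟩ h' ⟨k', x', hx', ho', rfl⟩
    rw [hs.own_fix_unique hx hx' ho ho']
  · rw [← e.cut_log hf hp (hs.own_valid k x hx).1]
    rfl

theorem aware_eq_some (hf : 3 * f < n) {τ : ℕ} {p : Fin n} (hp : e.Good τ p) {q : Fin n} {t : ℕ}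
    {h : History m n V} : (logProtocol n m V f).aware (e.st τ p) q t = some h ↔
      ∃ (k : ℕ) (x : Entry n m V), ((e.loc τ p).logs q)[k]? = some x ∧ x.op = .fix t ∧
        h = hist (cut e.AcceptedEver x.clock) := by
  have hs := e.sound hf hp
  refine Iff.trans (pick_eq_some ?_) (exists₂_congr fun k x => and_congr_right fun hx => ?_)
  · rintro h ⟨k, x, hx, ho, rfl⟩ h' ⟨k', x', hx', ho', rfl⟩
    rw [(e.coherent hf).fix_unique (e.acceptedEver_of_log hp hx)
      (e.acceptedEver_of_log hp hx') ho ho']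
  · rw [← e.cut_log hf hp (hs.logs_valid q k x hx).1]
    rfl

theorem issued_eq_some (hf : 3 * f < n) {τ : ℕ} {p : Fin n} (hp : e.Good τ p) {t : ℕ}
    {r : Fin m} {v : V} : (logProtocol n m V f).issued (e.st τ p) t r = some v ↔
      ∃ (k : ℕ) (x : Entry n m V), (e.loc τ p).own[k]? = some x ∧ x.op = .write t r v := by
  refine Iff.trans (pick_eq_some ?_) Iff.rfl
  rintro v ⟨k, x, hx, ho⟩ v' ⟨k', x', hx', ho'⟩
  exact (e.sound hf hp).own_write_unique hx hx' ho ho'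

theorem accepted_eq_some (hf : 3 * f < n) {τ : ℕ} {p : Fin n} (hp : e.Good τ p) {t : ℕ}
    {r : Fin m} {i : Fin n} {v : V} :
    (logProtocol n m V f).accepted (e.st τ p) t r i = some v ↔
      ∃ (k : ℕ) (x : Entry n m V), ((e.loc τ p).logs i)[k]? = some x ∧ x.op = .write t r v :=
  isHist_hist (e.coherent hf) (fun _ _ _ hx => e.acceptedEver_of_log hp hx) t r i v

noncomputable def board (τ : ℕ) : History m n V := hist (e.AcceptedBy τ)

theorem isHist_board (hf : 3 * f < n) (τ : ℕ) : IsHist (e.board τ) (e.AcceptedBy τ) :=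
  isHist_hist (e.coherent hf) fun _ _ _ hx => ⟨τ, hx⟩

theorem isTrueBlackboard (hf : 3 * f < n) : e.IsTrueBlackboard e.board := by
  intro τ t r i v
  rw [e.isHist_board hf]
  constructor
  · rintro ⟨k, x, ⟨σ, hσ, p, hp, hx⟩, ho⟩
    exact ⟨σ, hσ, p, hp, (e.accepted_eq_some hf hp).2 ⟨k, x, hx, ho⟩⟩
  · rintro ⟨σ, hσ, p, hp, h⟩
    obtain ⟨k, x, hx, ho⟩ := (e.accepted_eq_some hf hp).1 h
    exact ⟨k, x, ⟨σ, hσ, p, hp, hx⟩, ho⟩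

theorem persistent (hf : 3 * f < n) : e.Persistent := by
  intro p τ τ' hτ hp' t _
  have hp := hp'.of_le hτ
  have g := e.grows hf hτ hp'
  refine ⟨fun r i v h => ?_, ?_, fun h hv => ?_, fun hv => ?_⟩
  · obtain ⟨k, x, hx, ho⟩ := (e.accepted_eq_some hf hp).1 h
    exact (e.accepted_eq_some hf hp').2 ⟨k, x, getElem?_of_prefix (g.logs i) hx, ho⟩
  · rintro ⟨k, x, hx, ho⟩
    exact ⟨k, x, getElem?_of_prefix g.own hx, ho⟩
  · obtain ⟨k, x, hx, ho⟩ := (e.view_eq_some hf hp).1 hv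
    exact (e.view_eq_some hf hp').2 ⟨k, x, getElem?_of_prefix g.own hx, ho⟩
  · obtain ⟨h, hv⟩ := Option.ne_none_iff_exists'.1 hv
    obtain ⟨k, x, hx, ho, _⟩ := (e.view_eq_some hf hp).1 hv
    have hx' := (e.own_valid hf hp hx).op
    rw [ho] at hx'
    obtain ⟨⟨k', y, hy, hyo⟩, _⟩ := hx'
    exact ⟨k', y, hy.2, hyo⟩

theorem writesProperly (hf : 3 * f < n) : e.WritesProperly e.board := by
  refine ⟨fun i t r => ?_, fun τ i ζ hev => ?_, fun τ i hi t _ r v hv => ?_⟩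
  · by_contra h
    obtain ⟨v, k, x, hx, _⟩ := nonempty_of_pick h
    simp [logProtocol, LState.initial] at hx
  · have hgood : e.Good τ i := by
      have hs := e.conf_succ τ
      rw [hev] at hs
      exact hs.1
    have hgood' : e.Good (τ + 1) i := by
      have hs := e.conf_succ τ
      rw [hev] at hs
      unfold Good
      rw [hs.2]
      exact hgood
    have hs := e.sound hf hgood
    have hown : (e.loc (τ + 1) i).own =
        (e.loc τ i).own ++ [(e.loc τ i).nextEntry f i ζ] := by
      rw [e.loc_compute hev]; rfl
    have hiss : ∀ t r, (∀ v, (e.loc τ i).nextOp f i ζ ≠ .write t r v) →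
        (logProtocol n m V f).issued (e.st (τ + 1) i) t r =
          (logProtocol n m V f).issued (e.st τ i) t r := by
      intro t r hne
      refine Option.ext fun v => ?_
      rw [e.issued_eq_some hf hgood', e.issued_eq_some hf hgood]
      constructor
      · rintro ⟨k, x, hx, ho⟩
        rw [hown] at hx
        rcases getElem?_concat hx with hx | ⟨_, rfl⟩
        · exact ⟨k, x, hx, ho⟩
        · exact absurd ho (hne v)
      · rintro ⟨k, x, hx, ho⟩
        rw [hown]
        exact ⟨k, x, getElem?_of_prefix (List.prefix_append _ _) hx, ho⟩
    have htar : (logProtocol n m V f).target i (e.st τ i) (fun j => (e.conf τ).inb j i) =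
      (e.loc τ i).nextCell f i := rfl
    rw [htar]
    rcases hcell : (e.loc τ i).nextCell f i with _ | ⟨t, r⟩
    · funext t r
      exact hiss t r fun v => nextCell_none f i _ ζ hcell t r v
    · obtain ⟨hfd, ht, hw, hop⟩ := nextCell_some f i _ ζ hcell
      dsimp only at ht hw hop ⊢
      subst ht
      refine ⟨Nat.le_add_left 1 _, ?_, ?_, fun t' r' hne => hiss t' r' fun v hv => hne ?_,
        fun r' hr' => ?_, fun ht => ?_, ?_⟩
      · by_contra h
        obtain ⟨v, hv⟩ := Option.ne_none_iff_exists'.1 h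
        obtain ⟨k, x, hx, ho⟩ := (e.issued_eq_some hf hgood).1 hv
        rcases hw.lex k x _ _ _ hx ho with h1 | ⟨_, h1⟩
        · exact lt_irrefl _ h1
        · exact lt_irrefl _ h1
      · refine (e.issued_eq_some hf hgood').2 ⟨(e.loc τ i).own.length,
          (e.loc τ i).nextEntry f i ζ, ?_, hop⟩
        rw [hown]
        simp
      · rw [hop] at hv
        cases hv
        rfl
      · obtain ⟨k, x, v, hx, ho⟩ := hw.rows r' hr'
        rw [(e.issued_eq_some hf hgood).2 ⟨k, x, hx, ho⟩]
        simp
      · obtain ⟨k, x, hx, ho⟩ := hw.fixed ht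
        have hx' : (e.loc (τ + 1) i).own[k]? = some x := by
          rw [hown]
          exact getElem?_of_prefix (List.prefix_append _ _) hx
        rw [(e.view_eq_some hf hgood').2 ⟨k, x, hx', ho, rfl⟩]
        simp
      · intro hc
        have := ((hs.complete_iff _).1 hc).2
        omega
  · obtain ⟨k, x, hx, ho⟩ := (e.isHist_board hf τ t r i v).1 hv
    exact (e.issued_eq_some hf hi).2 ⟨k, x, e.own_of_acceptedBy hf hi hx, ho⟩

theorem board_prefix (hf : 3 * f < n) (t τ : ℕ) (i : Fin n) (r r' : Fin m) (hr : r ≤ r')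
    (h : e.board τ t r' i ≠ none) : e.board τ t r i ≠ none := by
  rcases hr.eq_or_lt with rfl | hr
  · exact h
  · obtain ⟨v, hv⟩ := Option.ne_none_iff_exists'.1 h
    obtain ⟨k, x, ⟨σ, hσ, p, hp, hx⟩, ho⟩ := (e.isHist_board hf τ t r' i v).1 hv
    have hx' := ((e.sound hf hp).logs_valid i k x hx).2.op
    rw [ho] at hx'
    obtain ⟨k', y, w, hy, hyo⟩ := hx'.rows r hr
    rw [(e.isHist_board hf τ t r i w).2 ⟨k', y, ⟨σ, hσ, p, hp, hy.2⟩, hyo⟩]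
    simp

theorem many_full (hf : 3 * f < n) {τ t : ℕ} (h : e.CompleteBy τ t) :
    Many f (FullColumn (e.board τ t)) := by
  obtain ⟨σ, hσ, p, hp, k, x, hx, ho⟩ := h
  have hx : (e.loc σ p).own[k]? = some x := hx
  refine (closed_of_valid (e.own_valid hf hp hx) ho).mono fun j hj r => ?_
  obtain ⟨k', y, v, hy, hyo, _⟩ := hj r
  have := e.acceptedBy_of_cut hf hσ hp ((e.sound hf hp).own_valid k x hx).1 hy
  rw [(e.isHist_board hf τ t r j v).2 ⟨k', y, this, hyo⟩]
  simp

theorem isHist_cut (hf : 3 * f < n) (C : Fin n → ℕ) :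
    IsHist (hist (cut e.AcceptedEver C)) (cut e.AcceptedEver C) :=
  isHist_hist (e.coherent hf) fun _ _ _ hx => hx.2

theorem fixCut_agrees (hf : 3 * f < n) {σ τ : ℕ} (hτ : σ ≤ τ) {p : Fin n} (hp : e.Good σ p)
    {C : Fin n → ℕ} (hC : ∀ j, C j ≤ ((e.loc σ p).logs j).length) {t : ℕ}
    (hfix : FixCut f e.AcceptedEver C t) :
    AgreesUpToLast (e.board τ) t (hist (cut e.AcceptedEver C)) :=
  (e.coherent hf).agreesUpToLast hf hfix (e.isHist_cut hf C) (e.isHist_board hf τ)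
    (fun _ _ _ h => ⟨τ, h⟩) fun _ _ _ h => e.acceptedBy_of_cut hf hτ hp hC h

theorem fixCut_disagreements (hf : 3 * f < n) {σ τ : ℕ} (hτ : σ ≤ τ) {p : Fin n}
    (hp : e.Good σ p) {C : Fin n → ℕ} (hC : ∀ j, C j ≤ ((e.loc σ p).logs j).length) {t : ℕ}
    (ht : 1 ≤ t) (hfix : FixCut f e.AcceptedEver C t) :
    (disagreements t (hist (cut e.AcceptedEver C)) (e.board τ)).encard ≤ f := by
  have H := e.fixCut_agrees hf hτ hp hC hfix
  refine encard_disagreements_le ht H (agreesUpToLast_self _ t)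
    (((e.coherent hf).common_full hf hfix).mono fun j hj r => ?_)
  have := hj C hfix _ (e.isHist_cut hf C) r
  exact ⟨this, by rwa [← H.ne_none ht le_rfl this]⟩

theorem fixCut_disagreements_two (hf : 3 * f < n) {σ σ' : ℕ} {p p' : Fin n}
    (hp : e.Good σ p) {C : Fin n → ℕ} (hC : ∀ j, C j ≤ ((e.loc σ p).logs j).length)
    (hp' : e.Good σ' p') {C' : Fin n → ℕ} (hC' : ∀ j, C' j ≤ ((e.loc σ' p').logs j).length)
    {t : ℕ} (ht : 1 ≤ t) (hfix : FixCut f e.AcceptedEver C t)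
    (hfix' : FixCut f e.AcceptedEver C' t) :
    (disagreements t (hist (cut e.AcceptedEver C)) (hist (cut e.AcceptedEver C'))).encard ≤ f :=
  encard_disagreements_le ht (e.fixCut_agrees hf (le_max_left σ σ') hp hC hfix)
    (e.fixCut_agrees hf (le_max_right σ σ') hp' hC' hfix')
    (((e.coherent hf).common_full hf hfix).mono fun _ hj r =>
      ⟨hj C hfix _ (e.isHist_cut hf C) r, hj C' hfix' _ (e.isHist_cut hf C') r⟩)

/-! ### Views of the writers -/

/-- The view of process `q` of the matrices `1, …, t`, as known to all good processes. -/
noncomputable def knownView (q : Fin n) (t : ℕ) : History m n V :=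
  (pick {h | ∃ k x, e.AcceptedEver q k x ∧ x.op = .fix t ∧
    h = hist (cut e.AcceptedEver x.clock)}).getD fun _ _ _ => none

theorem knownView_eq (hf : 3 * f < n) {q : Fin n} {k t : ℕ} {x : Entry n m V}
    (hx : e.AcceptedEver q k x) (ho : x.op = .fix t) :
    e.knownView q t = hist (cut e.AcceptedEver x.clock) := by
  unfold knownView
  have key : pick {h | ∃ k x, e.AcceptedEver q k x ∧ x.op = .fix t ∧
      h = hist (cut e.AcceptedEver x.clock)} = some (hist (cut e.AcceptedEver x.clock)) := by
    refine (pick_eq_some ?_).2 ⟨k, x, hx, ho, rfl⟩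
    rintro h ⟨k, x, hx, ho, rfl⟩ h' ⟨k', x', hx', ho', rfl⟩
    rw [(e.coherent hf).fix_unique hx hx' ho ho']
  rw [key]
  rfl

/-- Before a good process writes to the matrix `t + 1`, its view of the matrix `t` has been
accepted and acknowledged. -/
theorem fix_of_issued (hf : 3 * f < n) {τ : ℕ} {q : Fin n} (hq : e.Good τ q) {t : ℕ} (ht : 1 ≤ t)
    {r : Fin m} (h : (logProtocol n m V f).issued (e.st τ q) (t + 1) r ≠ none) :
    ∃ (k : ℕ) (x : Entry n m V), (e.loc τ q).own[k]? = some x ∧ e.AcceptedEver q k x ∧ x.op = .fix t ∧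
      ∃ C, Acked f (cut e.AcceptedEver C) q k (t + 1) := by
  obtain ⟨v, hv⟩ := Option.ne_none_iff_exists'.1 h
  obtain ⟨k', x', hx', ho'⟩ := (e.issued_eq_some hf hq).1 hv
  have hs := e.sound hf hq
  obtain ⟨hlen, hw⟩ := hs.own_valid k' x' hx'
  have hw := hw.op
  rw [ho'] at hw
  obtain ⟨k, x, hx, ho⟩ := hw.fixed (by omega)
  have hA := hw.acked k x hx (by rw [ho]; simp)
  -- A single acknowledging entry in the logs of `q` suffices: these logs cover its clock, so `q`
  -- has accepted its own fixing entry.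
  obtain ⟨y, _, ⟨l, z, hz, hk, _⟩, _⟩ := e.many_alwaysGood.exists_three hf hA hA
  have hk' := hk.trans_le ((hs.logs_valid y l z hz.2).1 q)
  have hacc := e.acceptedEver_of_log hq (List.getElem?_eq_getElem hk')
  have hown := e.own_of_acceptedBy hf hq
    ⟨τ, le_rfl, q, hq, List.getElem?_eq_getElem hk'⟩
  rw [hx.2] at hown
  rw [← Option.some.inj hown] at hacc
  rw [e.cut_log hf hq hlen] at hA
  exact ⟨k, x, hx.2, hacc, ho, _, hA⟩

theorem fix_of_writesTo (hf : 3 * f < n) {q : Fin n} {t : ℕ} (ht : 1 ≤ t)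
    (h : e.WritesTo e.board q (t + 1)) : ∃ k x, e.AcceptedEver q k x ∧ x.op = .fix t ∧
      ∃ C, Acked f (cut e.AcceptedEver C) q k (t + 1) := by
  obtain ⟨τ, r, h | ⟨hq, h⟩⟩ := h
  · obtain ⟨v, hv⟩ := Option.ne_none_iff_exists'.1 h
    obtain ⟨k', x', hx', ho'⟩ := (e.isHist_board hf τ _ r q v).1 hv
    have hw := ((e.coherent hf).valid q k' x' ⟨τ, hx'⟩).op
    rw [ho'] at hw
    obtain ⟨k, x, hx, ho⟩ := hw.fixed (by omega)
    exact ⟨k, x, hx.2, ho, _, hw.acked k x hx (by rw [ho]; simp)⟩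
  · obtain ⟨k, x, _, h⟩ := e.fix_of_issued hf hq ht h
    exact ⟨k, x, h⟩

theorem view_of_issued (hf : 3 * f < n) {τ : ℕ} {q : Fin n} (hq : e.Good τ q) {t : ℕ}
    (ht : 1 ≤ t) {r : Fin m}
    (h : (logProtocol n m V f).issued (e.st τ q) (t + 1) r ≠ none) :
    (logProtocol n m V f).view (e.st τ q) t = some (e.knownView q t) := by
  obtain ⟨k, x, hx, hacc, ho, _⟩ := e.fix_of_issued hf hq ht h
  exact (e.view_eq_some hf hq).2 ⟨k, x, hx, ho, e.knownView_eq hf hacc ho⟩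

/-- The entry by which `q` fixed `t` was acknowledged for `t + 1`, so by `clock_lt` it lies below
the clock at which `p` fixes `t + 1`. The logs of `p` cover its clock, and its legality gives the
relations to the truth even if `q` is corrupted. -/
theorem known_of_view (hf : 3 * f < n) {q : Fin n} {t : ℕ} (ht : 1 ≤ t)
    (h : e.WritesTo e.board q (t + 1)) {σ : ℕ} {p : Fin n} (hp : e.Good σ p)
    (hv : (logProtocol n m V f).view (e.st σ p) (t + 1) ≠ none) :
    (logProtocol n m V f).aware (e.st σ p) q t = some (e.knownView q t) ∧
    (e.Good σ q → (logProtocol n m V f).view (e.st σ q) t = some (e.knownView q t)) ∧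
    (∀ τ ≥ σ, AgreesUpToLast (e.board τ) t (e.knownView q t) ∧
      (disagreements t (e.knownView q t) (e.board τ)).encard ≤ f) := by
  obtain ⟨k, x, hx, ho, C, hA⟩ := e.fix_of_writesTo hf ht h
  obtain ⟨h, hv⟩ := Option.ne_none_iff_exists'.1 hv
  obtain ⟨k', x', hx', ho', _⟩ := (e.view_eq_some hf hp).1 hv
  have hs := e.sound hf hp
  have hk := ((e.coherent hf).clock_lt hf (e.own_fixCut hf hp hx' ho') le_rfl hA).trans_le
    ((hs.own_valid k' x' hx').1 q)
  have hlog := e.log_of_acceptedEver hf hp hx hk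
  have heq := e.knownView_eq hf hx ho
  have hC := (hs.logs_valid q k x hlog).1
  have hfix := (e.coherent hf).fixCut hx ho
  refine ⟨(e.aware_eq_some hf hp).2 ⟨k, x, hlog, ho, heq⟩, fun hq => ?_, fun τ hτ => ?_⟩
  · exact (e.view_eq_some hf hq).2 ⟨k, x, e.own_of_acceptedBy hf hq ⟨σ, le_rfl, p, hp, hlog⟩,
      ho, heq⟩
  · rw [heq]
    exact ⟨e.fixCut_agrees hf hτ hp hC hfix, e.fixCut_disagreements hf hτ hp hC ht hfix⟩

end Execution

/-! ### Progress -/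

theorem Acked.mono {R R' : Entries n m V} (h : ∀ j k x, R j k x → R' j k x) {j : Fin n} {k t : ℕ}
    (hA : Acked f R j k t) : Acked f R' j k t :=
  Many.mono hA fun _ ⟨l, x, hx, hk⟩ => ⟨l, x, h _ _ _ hx, hk⟩

theorem Closed.mono {R R' : Entries n m V} (h : ∀ j k x, R j k x → R' j k x) {t : ℕ}
    (hC : Closed f R t) : Closed f R' t :=
  Many.mono hC fun _ hj r =>
    let ⟨k, x, v, hx, ho, hA⟩ := hj r
    ⟨k, x, v, h _ _ _ hx, ho, hA.mono h⟩

theorem nextOp_fix {i : Fin n} {s : LState n m V} (ζ : V) (h : s.fixed < s.done)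
    (hR : Reported f (rel s.logs) s.done) : s.nextOp f i ζ = .fix s.done := by
  simp [LState.nextOp, h, hR]

theorem nextOp_complete {i : Fin n} {s : LState n m V} (ζ : V) (h : ¬ s.fixed < s.done)
    (hC : Closed f (rel s.logs) (s.done + 1)) : s.nextOp f i ζ = .complete (s.done + 1) := by
  simp [LState.nextOp, h, hC]

theorem nextOp_ne_tick {i : Fin n} {s : LState n m V} (ζ : V) (h : ¬ s.fixed < s.done)
    {r : Fin m} (hw : s.CanWrite f i r) : s.nextOp f i ζ ≠ .tick := by
  unfold LState.nextOp
  rw [if_neg h]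
  split_ifs
  · simp
  · obtain ⟨r', hr'⟩ := Option.ne_none_iff_exists'.1
      (pick_ne_none (S := {r | s.CanWrite f i r}) ⟨r, hw⟩)
    simp [hr']

namespace Execution

open Filter

variable {e : Execution (logProtocol n m V f) f}

/-- Fairness grants only a first compute event outright, but each one sends a message to the process
itself, whose delivery is followed by another. -/
theorem Fair.exists_compute (h : e.Fair) {p : Fin n} (hp : e.AlwaysGood p) (T : ℕ) :
    ∃ τ ≥ T, ∃ ζ, e.event τ = .compute p ζ := by
  induction T with
  | zero =>
    obtain ⟨τ, hτ⟩ := h.1 p hp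
    exact ⟨τ, Nat.zero_le _, hτ⟩
  | succ T ih =>
    obtain ⟨τ, hτ, ζ, hc⟩ := ih
    obtain ⟨τ', hτ', hd⟩ := h.2.1 p p hp hp (τ + 1) _ (e.outbox_compute hc p)
    obtain ⟨τ'', hτ'', hc'⟩ := h.2.2 p p hp hp τ' _ hd
    exact ⟨τ'', by omega, hc'⟩

theorem eventually_of_step {Q : ℕ → Prop} (hQ : ∀ τ, Q τ → Q (τ + 1)) {T : ℕ} (h : Q T) :
    ∀ᶠ τ in atTop, Q τ :=
  eventually_atTop.2 ⟨T, fun _ hτ => Nat.le_induction h (fun σ _ => hQ σ) _ hτ⟩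

theorem Fair.eventually_of_compute (h : e.Fair) {p : Fin n} (hp : e.AlwaysGood p) {Q : ℕ → Prop}
    (hQ : ∀ τ, Q τ → Q (τ + 1))
    (hc : ∀ᶠ τ in atTop, ∀ ζ, e.event τ = .compute p ζ → Q (τ + 1)) : ∀ᶠ τ in atTop, Q τ := by
  obtain ⟨T, hT⟩ := eventually_atTop.1 hc
  obtain ⟨τ, hτ, ζ, hev⟩ := h.exists_compute hp T
  exact eventually_of_step hQ (hT τ hτ ζ hev)

theorem AlwaysGood.grows (hf : 3 * f < n) {p : Fin n} (hp : e.AlwaysGood p) {τ τ' : ℕ}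
    (hτ : τ ≤ τ') : Grows (e.loc τ p) (e.loc τ' p) :=
  e.grows hf hτ (hp τ')

/-- The next packet of `i` repeats `x`; once delivered, it stays in the buffer until a compute event
of `j` absorbs it. -/
theorem Fair.eventually_heard (h : e.Fair) (hf : 3 * f < n) {i j : Fin n} (hi : e.AlwaysGood i)
    (hj : e.AlwaysGood j) {τ₀ : ℕ} {g : Tag n} {x : Entry n m V}
    (hx : (e.loc τ₀ i).said g = some x) : ∀ᶠ τ in atTop, x ∈ (e.loc τ j).heard i g := by
  obtain ⟨τ₁, h₁, ζ, hev⟩ := h.exists_compute hi τ₀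
  obtain ⟨τ₂, h₂, hd⟩ := h.2.1 i j hi hj (τ₁ + 1) _ (e.outbox_compute hev j)
  have hin := e.inbox_deliver hd
  have hM := (hi.grows hf (show τ₀ ≤ τ₁ + 1 by omega)).said hx
  generalize (e.loc (τ₁ + 1) i).said = M at hin hM
  have habs : ∀ {τ ζ}, e.event τ = .compute j ζ → M ∈ e.inbox τ i j →
      x ∈ (e.loc (τ + 1) j).heard i g := by
    intro τ ζ hev hin
    rw [e.loc_compute hev]
    exact Or.inr ⟨M, hin, hM⟩
  have hmono : ∀ τ, x ∈ (e.loc τ j).heard i g → x ∈ (e.loc (τ + 1) j).heard i g :=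
    fun τ hτ => (hj.grows hf τ.le_succ).heard _ _ hτ
  have hkeep : ∀ᶠ τ in atTop, M ∈ e.inbox τ i j ∨ x ∈ (e.loc τ j).heard i g := by
    refine eventually_of_step (fun τ hτ => ?_) (Or.inl hin)
    rcases hτ with hτ | hτ
    · by_cases hc : ∃ ζ, e.event τ = .compute j ζ
      · obtain ⟨ζ, hc⟩ := hc
        exact Or.inr (habs hc hτ)
      · push Not at hc
        exact Or.inl (e.inbox_keep (hj τ) hc hτ)
    · exact Or.inr (hmono τ hτ)
  refine h.eventually_of_compute hj hmono (hkeep.mono fun τ hτ ζ hev => ?_)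
  exact hτ.elim (habs hev) (hmono τ)

theorem Fair.eventually_many (h : e.Fair) (hf : 3 * f < n) {g : Tag n} {x : Entry n m V}
    (hx : ∀ i, e.AlwaysGood i → ∃ τ, (e.loc τ i).said g = some x) {q : Fin n}
    (hq : e.AlwaysGood q) :
    ∀ᶠ τ in atTop, Many f fun z => x ∈ (e.loc τ q).heard z g := by
  have : ∀ᶠ τ in atTop, ∀ z, e.AlwaysGood z → x ∈ (e.loc τ q).heard z g := by
    refine eventually_all.2 fun z => ?_
    by_cases hz : e.AlwaysGood z
    · obtain ⟨τ, hτ⟩ := hx z hz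
      exact (h.eventually_heard hf hz hq hτ).mono fun _ hτ _ => hτ
    · exact Eventually.of_forall fun _ hz' => absurd hz' hz
  exact this.mono fun τ hτ => e.many_alwaysGood.mono hτ

theorem Fair.eventually_delivered_of_ready (h : e.Fair) (hf : 3 * f < n) {i : Fin n} {k : ℕ}
    {x : Entry n m V} {τ₀ : ℕ} (hE : e.EchoQuorum τ₀ i k x)
    (hr : ∀ j, e.AlwaysGood j → ∃ τ, ReadyCause f (e.loc τ j).heard i k x) {q : Fin n}
    (hq : e.AlwaysGood q) : ∀ᶠ τ in atTop, Delivered f (e.loc τ q).heard i k x := by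
  refine h.eventually_many hf (fun j hj => ?_) hq
  obtain ⟨τ, hτ⟩ := hr j hj
  obtain ⟨y, hy⟩ := Option.ne_none_iff_exists'.1 ((e.sound hf (hj τ)).ready_ne_none i k x hτ)
  refine ⟨τ, ?_⟩
  rw [hE.eq hf (e.echoQuorum_of_ready hf hj hy)]
  exact hy

/-- Every entry issued by a good process is confirmed everywhere. -/
theorem Fair.eventually_delivered_of_own (h : e.Fair) (hf : 3 * f < n) {i : Fin n}
    (hi : e.AlwaysGood i) {σ k : ℕ} {x : Entry n m V} (hx : (e.loc σ i).own[k]? = some x)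
    {q : Fin n} (hq : e.AlwaysGood q) :
    ∀ᶠ τ in atTop, Delivered f (e.loc τ q).heard i k x := by
  have hecho : ∀ j, e.AlwaysGood j → ∃ τ, (e.loc τ j).said (.echo i k) = some x := by
    intro j hj
    obtain ⟨τ, hτ, hστ⟩ := ((h.eventually_heard hf hi hj (g := .init k) hx).and
      (eventually_ge_atTop σ)).exists
    obtain ⟨y, hy⟩ := Option.ne_none_iff_exists'.1 ((e.sound hf (hj τ)).echo_ne_none i k x hτ)
    have h1 := e.own_of_echo hf (hj τ) (hi τ) hy
    rw [getElem?_of_prefix (hi.grows hf hστ).own hx] at h1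
    exact ⟨τ, by rw [Option.some.inj h1]; exact hy⟩
  have hmany := fun {j} (hj : e.AlwaysGood j) => (h.eventually_many hf hecho hj).exists
  obtain ⟨τ₀, h₀⟩ := hmany hq
  refine h.eventually_delivered_of_ready hf ⟨q, hq, h₀⟩ (fun j hj => ?_) hq
  obtain ⟨τ, hτ⟩ := hmany hj
  exact ⟨τ, Or.inl hτ⟩

/-- An entry confirmed for one good process is confirmed everywhere. -/
theorem Fair.eventually_delivered_of_delivered (h : e.Fair) (hf : 3 * f < n) {σ : ℕ} {p : Fin n}
    (hp : e.Good σ p) {i : Fin n} {k : ℕ} {x : Entry n m V}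
    (hd : Delivered f (e.loc σ p).heard i k x) {q : Fin n} (hq : e.AlwaysGood q) :
    ∀ᶠ τ in atTop, Delivered f (e.loc τ q).heard i k x := by
  refine h.eventually_delivered_of_ready hf (e.echoQuorum_of_delivered hf hp hd)
    (fun j hj => ?_) hq
  have : ∀ᶠ τ in atTop, ∀ z, e.AlwaysGood z ∧ x ∈ (e.loc σ p).heard z (.ready i k) →
      x ∈ (e.loc τ j).heard z (.ready i k) := by
    refine eventually_all.2 fun z => ?_
    by_cases hz : e.AlwaysGood z ∧ x ∈ (e.loc σ p).heard z (.ready i k)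
    · exact (h.eventually_heard hf hz.1 hj (e.said_of_heard hf (hz.1 σ) hp hz.2)).mono
        fun _ hτ _ => hτ
    · exact Eventually.of_forall fun _ hz' => absurd hz' hz
  obtain ⟨τ, hτ⟩ := this.exists
  -- At least `n - 2f > f` of the confirmers are never corrupted, which is enough for amplification
  -- at `j`.
  exact ⟨τ, Or.inr ((Many.lt_and hf e.many_alwaysGood hd).trans_le
    (Set.ncard_le_ncard fun z hz => hτ z hz))⟩

/-! ### Acceptance spreads -/

theorem Fair.eventually_length (h : e.Fair) (hf : 3 * f < n) {q i : Fin n} (hq : e.AlwaysGood q)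
    {k : ℕ} {x : Entry n m V}
    (hd : ∀ᶠ τ in atTop, Delivered f (e.loc τ q).heard i k x)
    (hk : ∀ᶠ τ in atTop, k ≤ ((e.loc τ q).logs i).length)
    (hC : ∀ j, ∀ᶠ τ in atTop, x.clock j ≤ ((e.loc τ q).logs j).length)
    (hv : ∀ᶠ τ in atTop, ((e.loc τ q).logs i).length = k →
      Valid f (fun k' y => ((e.loc τ q).logs i)[k']? = some y) (cut e.AcceptedEver x.clock) i x) :
    ∀ᶠ τ in atTop, k < ((e.loc τ q).logs i).length := by
  refine h.eventually_of_compute hq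
    (fun τ hτ => hτ.trans_le ((hq.grows hf τ.le_succ).logs i).length_le) ?_
  filter_upwards [hd, hk, eventually_all.2 hC, hv] with τ hd hk hC hv ζ hev
  have hg := (hq.grows hf τ.le_succ).logs i
  rcases hk.eq_or_lt with hk | hk
  · have hacc : Acceptable f (e.loc τ q).logs i x := by
      refine ⟨hC, ?_⟩
      rw [e.cut_log hf (hq τ) hC]
      exact hv hk.symm
    -- Since `x` qualifies, some entry is appended; which one is picked does not matter for the
    -- length.
    have hne : pick {y | Delivered f ((e.loc τ q).hear fun j => e.inbox τ j q) i
        ((e.loc τ q).logs i).length y ∧ Acceptable f (e.loc τ q).logs i y} ≠ none := by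
      refine pick_ne_none ⟨x, ?_, hacc⟩
      rw [← hk]
      exact hd.mono fun _ _ => Set.subset_union_left
    obtain ⟨y, hy⟩ := Option.ne_none_iff_exists'.1 hne
    rw [e.loc_compute hev]
    simp [LState.next, hy, hk]
  · exact hk.trans_le hg.length_le

/-- Induction on the time at `p`: a newly accepted entry refers only to logs that `p` held before,
and `q` catches up with those by induction. -/
theorem Fair.eventually_logs_length (h : e.Fair) (hf : 3 * f < n) {σ : ℕ} {p : Fin n}
    (hp : e.Good σ p) {q : Fin n} (hq : e.AlwaysGood q) (i : Fin n) :
    ∀ᶠ τ in atTop, ((e.loc σ p).logs i).length ≤ ((e.loc τ q).logs i).length := by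
  induction σ generalizing i with
  | zero => rw [loc_zero]; simp [LState.initial]
  | succ σ ih =>
    have hp' := hp.of_le σ.le_succ
    have ih := ih hp'
    rcases e.loc_succ hp' with hl | ⟨ζ, hev⟩
    · rw [hl]; exact ih i
    · have hlogs : (e.loc (σ + 1) p).logs i = (e.loc σ p).logs i ++
          (pick {y | Delivered f ((e.loc σ p).hear fun j => e.inbox σ j p) i
            ((e.loc σ p).logs i).length y ∧ Acceptable f (e.loc σ p).logs i y}).toList := by
        rw [e.loc_compute hev]; rfl
      rcases hx : pick {y | Delivered f ((e.loc σ p).hear fun j => e.inbox σ j p) i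
            ((e.loc σ p).logs i).length y ∧ Acceptable f (e.loc σ p).logs i y} with _ | x
      · rw [hx] at hlogs
        rw [hlogs]
        simpa using ih i
      · rw [hx] at hlogs
        have hget : ((e.loc (σ + 1) p).logs i)[((e.loc σ p).logs i).length]? = some x := by
          rw [hlogs]; simp
        have hE := e.acceptedEver_of_log hp hget
        have hlt := h.eventually_length hf hq
          (h.eventually_delivered_of_delivered hf hp ((e.sound hf hp).delivered _ _ _ hget) hq)
          (ih i) (fun j => (ih j).mono fun τ hτ => ((mem_of_pick hx).2.1 j).trans hτ)
          (Eventually.of_forall fun τ hlen => by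
            have hv := (e.coherent hf).valid _ _ _ hE
            convert hv using 3 with k' y
            exact ⟨fun hy => ⟨hlen ▸ (List.getElem?_eq_some_iff.1 hy).1,
              e.acceptedEver_of_log (hq τ) hy⟩,
              fun hy => e.log_of_acceptedEver hf (hq τ) hy.2 (hlen ▸ hy.1)⟩)
        rw [hlogs]
        simpa using hlt

/-- Every entry accepted by a good process is accepted everywhere. -/
theorem Fair.eventually_logs (h : e.Fair) (hf : 3 * f < n) {σ : ℕ} {p : Fin n}
    (hp : e.Good σ p) {q : Fin n} (hq : e.AlwaysGood q) :
    ∀ᶠ τ in atTop, ∀ i k x, rel (e.loc σ p).logs i k x → rel (e.loc τ q).logs i k x := by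
  filter_upwards [eventually_all.2 (h.eventually_logs_length hf hp hq)] with τ hτ i k x hx
  exact e.log_of_acceptedEver hf (hq τ) (e.acceptedEver_of_log hp hx)
    ((List.getElem?_eq_some_iff.1 hx).1.trans_le (hτ i))

/-- Induction on the position: an entry's clock covers only what `i` itself had accepted, which
reaches `q` by `eventually_logs_length`. -/
theorem Fair.eventually_own_length (h : e.Fair) (hf : 3 * f < n) {i : Fin n}
    (hi : e.AlwaysGood i) {σ k : ℕ} (hk : k ≤ (e.loc σ i).own.length)
    {q : Fin n} (hq : e.AlwaysGood q) : ∀ᶠ τ in atTop, k ≤ ((e.loc τ q).logs i).length := by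
  induction k with
  | zero => exact Eventually.of_forall fun _ => Nat.zero_le _
  | succ k ih =>
    have hx := List.getElem?_eq_getElem (Nat.lt_of_succ_le hk)
    have hlen := ((e.sound hf (hi σ)).own_valid k _ hx).1
    refine h.eventually_length hf hq (h.eventually_delivered_of_own hf hi hx hq)
      (ih (by omega)) (fun j => (h.eventually_logs_length hf (hi σ) hq j).mono
        fun τ hτ => (hlen j).trans hτ) ?_
    filter_upwards [eventually_ge_atTop σ] with τ hτ hlen'
    have hv := e.own_valid hf (hi σ) hx
    have hown : ∀ k' y, ((e.loc τ q).logs i)[k']? = some y → (e.loc τ i).own[k']? = some y :=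
      fun k' y hy => e.own_of_acceptedBy hf (hi τ) ⟨τ, le_rfl, q, hq τ, hy⟩
    convert hv using 3 with k' y
    rw [← before_eq (hi.grows hf hτ).own (by omega)]
    refine ⟨fun hy => ⟨hlen' ▸ (List.getElem?_eq_some_iff.1 hy).1, hown _ _ hy⟩,
      fun hy => ?_⟩
    have hget := List.getElem?_eq_getElem (hlen' ▸ hy.1 : k' < ((e.loc τ q).logs i).length)
    rw [hget, ← hown _ _ hget, hy.2]

/-- Every entry issued by a good process is accepted everywhere. -/
theorem Fair.eventually_own (h : e.Fair) (hf : 3 * f < n) {i : Fin n}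
    (hi : e.AlwaysGood i) {σ k : ℕ} {x : Entry n m V} (hx : (e.loc σ i).own[k]? = some x)
    {q : Fin n} (hq : e.AlwaysGood q) : ∀ᶠ τ in atTop, rel (e.loc τ q).logs i k x := by
  filter_upwards [h.eventually_own_length hf hi (k := k + 1)
    (List.getElem?_eq_some_iff.1 hx).1 hq, eventually_ge_atTop σ] with τ hτ hστ
  have hget := List.getElem?_eq_getElem (Nat.lt_of_succ_le hτ)
  have := e.own_of_acceptedBy hf (hi τ) ⟨τ, le_rfl, q, hq τ, hget⟩
  rw [getElem?_of_prefix (hi.grows hf hστ).own hx] at this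
  unfold rel
  rw [hget, this]

/-! ### Matrices get filled, completed and fixed -/

/-- Any entry issued after accepting the log of `j` up to `K`, even a tick, is an acknowledgement,
as its level stays below `t`. -/
theorem Fair.eventually_acked (h : e.Fair) (hf : 3 * f < n) {t : ℕ}
    (hdone : ∀ y, e.AlwaysGood y → ∀ τ, (e.loc τ y).done < t) {j : Fin n} (hj : e.AlwaysGood j)
    {σ K : ℕ} (hK : K ≤ (e.loc σ j).own.length) {q : Fin n} (hq : e.AlwaysGood q) :
    ∀ᶠ τ in atTop, ∀ k < K, Acked f (rel (e.loc τ q).logs) j k t := by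
  have : ∀ᶠ τ in atTop, ∀ y, e.AlwaysGood y →
      ∃ l x, rel (e.loc τ q).logs y l x ∧ K ≤ x.clock j ∧ x.lev < t := by
    refine eventually_all.2 fun y => ?_
    by_cases hy : e.AlwaysGood y
    · obtain ⟨T, hT⟩ := eventually_atTop.1 (h.eventually_own_length hf hj hK hy)
      obtain ⟨τ, hτ, ζ, hev⟩ := h.exists_compute hy T
      have hx : (e.loc (τ + 1) y).own[(e.loc τ y).own.length]? =
          some ((e.loc τ y).nextEntry f y ζ) := by
        rw [e.loc_compute hev]; simp [LState.next]
      refine (h.eventually_own hf hy hx hq).mono fun τ' hτ' _ => ⟨_, _, hτ', hT τ hτ, ?_⟩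
      have := hdone y hy (τ + 1)
      rw [e.loc_compute hev] at this
      exact this
    · exact Eventually.of_forall fun _ hy' => absurd hy' hy
  filter_upwards [this] with τ hτ k hk
  refine e.many_alwaysGood.mono fun y hy => ?_
  obtain ⟨l, x, hx, h1, h2⟩ := hτ y hy
  exact ⟨l, x, hx, hk.trans_le h1, h2⟩

theorem Fair.eventually_done_of_closed (h : e.Fair) (hf : 3 * f < n) {t : ℕ} {p : Fin n}
    (hp : e.AlwaysGood p) (hfix : ∀ᶠ τ in atTop, t ≤ (e.loc τ p).fixed)
    (hC : ∀ᶠ τ in atTop, Closed f (rel (e.loc τ p).logs) (t + 1)) :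
    ∀ᶠ τ in atTop, t + 1 ≤ (e.loc τ p).done := by
  refine h.eventually_of_compute hp (fun τ hτ => hτ.trans (hp.grows hf τ.le_succ).done) ?_
  filter_upwards [hfix, hC] with τ hfix hC ζ hev
  by_cases hd : t + 1 ≤ (e.loc τ p).done
  · exact hd.trans (hp.grows hf τ.le_succ).done
  · have hle := (e.sound hf (hp τ)).fixed_le
    have hdt : (e.loc τ p).done = t := by omega
    rw [← hdt] at hC
    rw [e.loc_compute hev]
    simp only [LState.next, nextOp_complete ζ (by omega) hC, LState.doneAfter]
    omega

/-- The closure seen by `p` is witnessed by entries that `p` has accepted, and all of these reach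
`q`. -/
theorem Fair.eventually_done_of_done (h : e.Fair) (hf : 3 * f < n) {t : ℕ} {p q : Fin n}
    (hp : e.AlwaysGood p) (hq : e.AlwaysGood q)
    (hfix : ∀ᶠ τ in atTop, t ≤ (e.loc τ q).fixed) {σ : ℕ} (hd : t + 1 ≤ (e.loc σ p).done) :
    ∀ᶠ τ in atTop, t + 1 ≤ (e.loc τ q).done := by
  refine h.eventually_done_of_closed hf hq hfix ?_
  have hs := e.sound hf (hp σ)
  obtain ⟨k, x, hx, ho⟩ := (hs.complete_iff (t + 1)).2 ⟨by omega, hd⟩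
  have hC := closed_of_valid (E := rel (e.loc σ p).logs) (hs.own_valid k x hx).2 ho
  filter_upwards [h.eventually_logs hf (hp σ) hq] with τ hτ
  exact hC.mono fun _ _ _ hx => hτ _ _ _ hx.2

/-- While no matrix after the `t`-th is complete, a good process fills its column. -/
theorem Fair.exists_write (h : e.Fair) (hf : 3 * f < n) {t : ℕ}
    (hdone : ∀ y, e.AlwaysGood y → ∀ τ, (e.loc τ y).done < t + 1) {j : Fin n}
    (hj : e.AlwaysGood j) (hfix : ∀ᶠ τ in atTop, t ≤ (e.loc τ j).fixed) (r : Fin m) :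
    ∃ (τ k : ℕ) (x : Entry n m V) (v : V), (e.loc τ j).own[k]? = some x ∧ x.op = .write (t + 1) r v := by
  induction r using WellFoundedLT.induction with
  | _ r ih =>
  by_contra! hnever
  have hrows : ∀ᶠ τ in atTop, ∀ r' < r, ∃ (k : ℕ) (x : Entry n m V) (v : V),
      (e.loc τ j).own[k]? = some x ∧ x.op = .write (t + 1) r' v := by
    refine eventually_all.2 fun r' => ?_
    by_cases hr' : r' < r
    · obtain ⟨σ, k, x, v, hx, ho⟩ := ih r' hr'
      filter_upwards [eventually_ge_atTop σ] with τ hτ _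
      exact ⟨k, x, v, getElem?_of_prefix (hj.grows hf hτ).own hx, ho⟩
    · exact Eventually.of_forall fun _ hr'' => absurd hr'' hr'
  obtain ⟨T, hT⟩ := eventually_atTop.1 (hrows.and hfix)
  have hlevel : ∀ τ ≥ T, (e.loc τ j).done = t ∧ (e.loc τ j).fixed = t := by
    intro τ hτ
    have h1 := (hT τ hτ).2
    have h2 := hdone j hj τ
    have h3 := (e.sound hf (hj τ)).fixed_le
    omega
  -- Rows above `r` are already written, row `r` never is, and rows below it would require row `r`,
  -- so no write is possible from `T` on.
  have htick : ∀ τ ≥ T, ∀ ζ, e.event τ = .compute j ζ →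
      (e.loc τ j).nextOp f j ζ = .tick := by
    intro τ hτ ζ hev
    obtain ⟨hd, hfd⟩ := hlevel τ hτ
    have hnew : (e.loc (τ + 1) j).own[(e.loc τ j).own.length]? =
        some ((e.loc τ j).nextEntry f j ζ) := by
      rw [e.loc_compute hev]; simp [LState.next]
    rcases next_cases f j (e.loc τ j) ζ with h1 | ⟨h1, _⟩ | ⟨_, _, h1⟩ | ⟨_, _, r', hw, _, h1⟩
    · exact h1
    · omega
    · have := hdone j hj (τ + 1)
      rw [e.loc_compute hev] at this
      simp only [LState.next, h1, LState.doneAfter] at this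
      omega
    · exfalso
      rw [hd] at h1
      unfold LState.CanWrite at hw
      rw [hd] at hw
      rcases lt_trichotomy r' r with hr | hr | hr
      · obtain ⟨k, x, v, hx, ho⟩ := (hT τ hτ).1 r' hr
        rcases hw.lex k x _ _ _ hx ho with h2 | ⟨_, h2⟩
        · exact lt_irrefl _ h2
        · exact lt_irrefl _ h2
      · subst hr
        exact hnever _ _ _ ζ hnew h1
      · obtain ⟨k, x, v, hx, ho⟩ := hw.rows r hr
        exact hnever _ _ _ v hx ho
  -- The entries that need acknowledgement thus lie below a fixed position, and acknowledgements
  -- catch up with them.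
  have hbound : ∀ τ ≥ T, ∀ k x, (e.loc τ j).own[k]? = some x → x.op ≠ .tick →
      k < (e.loc T j).own.length := by
    intro τ hτ
    induction τ, hτ using Nat.le_induction with
    | base => exact fun k x hx _ => (List.getElem?_eq_some_iff.1 hx).1
    | succ τ hτ ih =>
      intro k x hx ho
      rcases e.loc_succ (hj τ) with hl | ⟨ζ, hev⟩
      · rw [hl] at hx
        exact ih k x hx ho
      · rw [e.loc_compute hev] at hx
        rcases getElem?_concat hx with hx | ⟨_, rfl⟩
        · exact ih k x hx ho
        · exact absurd (htick τ hτ ζ hev) ho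
  obtain ⟨T', hT'⟩ := eventually_atTop.1 (h.eventually_acked hf hdone hj le_rfl hj (σ := T))
  obtain ⟨τ, hτ, ζ, hev⟩ := h.exists_compute hj (max T T')
  have hτT := (le_max_left _ _).trans hτ
  obtain ⟨hd, hfd⟩ := hlevel τ hτT
  have hs := e.sound hf (hj τ)
  -- By now row `r` may legally be written, so the next operation cannot be a tick: a contradiction.
  refine nextOp_ne_tick (r := r) ζ (by omega) ?_ (htick τ hτT ζ hev)
  unfold LState.CanWrite
  rw [hd]
  refine ⟨by omega, fun k x t' r' v' hx ho => ?_, fun r' hr' => ?_, fun ht => ?_,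
    fun k x hx ho => hT' τ ((le_max_right _ _).trans hτ) k (hbound τ hτT k x hx ho)⟩
  · have hle := hs.write_le k x t' r' v' hx ho
    rw [hfd] at hle
    rcases hle.lt_or_eq with hlt | rfl
    · exact Or.inl hlt
    · refine Or.inr ⟨rfl, ?_⟩
      by_contra hr
      rcases (not_lt.1 hr).eq_or_lt with rfl | hr
      · exact hnever _ _ _ _ hx ho
      · have hv := (hs.own_valid k x hx).2.op
        rw [ho] at hv
        obtain ⟨k', y, v, hy, hyo⟩ := hv.rows r hr
        exact hnever _ _ _ _ hy.2 hyo
  · obtain ⟨k, x, v, hx, ho⟩ := (hT τ hτT).1 r' hr'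
    exact ⟨k, x, v, hx, ho⟩
  · exact (hs.fix_iff _).2 ⟨by omega, by omega⟩

/-- Either some never-corrupted process completes matrix `t + 1` and the others follow, or none does
and then all their columns become full and acknowledged, which closes the matrix. -/
theorem Fair.eventually_done (h : e.Fair) (hf : 3 * f < n) {t : ℕ}
    (hfix : ∀ p, e.AlwaysGood p → ∀ᶠ τ in atTop, t ≤ (e.loc τ p).fixed) {p : Fin n}
    (hp : e.AlwaysGood p) : ∀ᶠ τ in atTop, t + 1 ≤ (e.loc τ p).done := by
  by_cases hdone : ∀ y, e.AlwaysGood y → ∀ τ, (e.loc τ y).done < t + 1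
  · refine h.eventually_done_of_closed hf hp (hfix p hp) ?_
    have : ∀ᶠ τ in atTop, ∀ j, e.AlwaysGood j → ∀ r, ∃ k x v, rel (e.loc τ p).logs j k x ∧
        x.op = .write (t + 1) r v ∧ Acked f (rel (e.loc τ p).logs) j k (t + 1) := by
      refine eventually_all.2 fun j => ?_
      by_cases hj : e.AlwaysGood j
      · have : ∀ᶠ τ in atTop, ∀ r, ∃ k x v, rel (e.loc τ p).logs j k x ∧
            x.op = .write (t + 1) r v ∧ Acked f (rel (e.loc τ p).logs) j k (t + 1) := by
          refine eventually_all.2 fun r => ?_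
          obtain ⟨σ, k, x, v, hx, ho⟩ := h.exists_write hf hdone hj (hfix j hj) r
          filter_upwards [h.eventually_own hf hj hx hp, h.eventually_acked hf hdone hj
            (K := k + 1) (List.getElem?_eq_some_iff.1 hx).1 hp] with τ h1 h2
          exact ⟨k, x, v, h1, ho, h2 k k.lt_succ_self⟩
        exact this.mono fun _ hτ _ => hτ
      · exact Eventually.of_forall fun _ hj' => absurd hj' hj
    exact this.mono fun τ hτ => e.many_alwaysGood.mono hτ
  · push Not at hdone
    obtain ⟨y, hy, σ, hσ⟩ := hdone
    exact h.eventually_done_of_done hf hy hp (hfix p hp) hσ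

theorem Fair.eventually_fixed (h : e.Fair) (hf : 3 * f < n) (t : ℕ) {p : Fin n}
    (hp : e.AlwaysGood p) : ∀ᶠ τ in atTop, t ≤ (e.loc τ p).fixed := by
  induction t generalizing p with
  | zero => exact Eventually.of_forall fun _ => Nat.zero_le _
  | succ t ih =>
    have hR : ∀ᶠ τ in atTop, Reported f (rel (e.loc τ p).logs) (t + 1) := by
      have : ∀ᶠ τ in atTop, ∀ y, e.AlwaysGood y →
          ∃ l x, rel (e.loc τ p).logs y l x ∧ x.op = .complete (t + 1) := by
        refine eventually_all.2 fun y => ?_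
        by_cases hy : e.AlwaysGood y
        · obtain ⟨σ, hσ⟩ := (h.eventually_done hf (fun _ => ih) hy).exists
          obtain ⟨k, x, hx, ho⟩ := ((e.sound hf (hy σ)).complete_iff (t + 1)).2 ⟨by omega, hσ⟩
          exact (h.eventually_own hf hy hx hp).mono fun τ hτ _ => ⟨k, x, hτ, ho⟩
        · exact Eventually.of_forall fun _ hy' => absurd hy' hy
      exact this.mono fun τ hτ => e.many_alwaysGood.mono hτ
    refine h.eventually_of_compute hp (fun τ hτ => hτ.trans (hp.grows hf τ.le_succ).fixed) ?_
    filter_upwards [hR, ih hp, h.eventually_done hf (fun _ => ih) hp] with τ hR hfix hd ζ hev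
    by_cases hlt : t + 1 ≤ (e.loc τ p).fixed
    · exact hlt.trans (hp.grows hf τ.le_succ).fixed
    · have hle := (e.sound hf (hp τ)).done_le
      -- The process has completed `t + 1`, and it cannot be more than one matrix ahead of its last
      -- fixed view.
      have hdt : (e.loc τ p).done = t + 1 := by omega
      rw [← hdt] at hR
      rw [e.loc_compute hev]
      simp only [LState.next, nextOp_fix ζ (by omega) hR, LState.fixedAfter]
      omega

theorem AlwaysGood.exists_accepted (hf : 3 * f < n) {p : Fin n} (hp : e.AlwaysGood p)
    {t : ℕ} {r : Fin m} {i : Fin n} {v : V} {k : ℕ} {x : Entry n m V} (ho : x.op = .write t r v)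
    (hx : ∀ᶠ τ in atTop, rel (e.loc τ p).logs i k x) :
    ∃ τ, (logProtocol n m V f).accepted (e.st τ p) t r i = some v := by
  obtain ⟨τ, hτ⟩ := hx.exists
  exact ⟨τ, (e.accepted_eq_some hf (hp τ)).2 ⟨k, x, hτ, ho⟩⟩

theorem Fair.progress (h : e.Fair) (hf : 3 * f < n) {p : Fin n} (hp : e.AlwaysGood p) {t : ℕ}
    (ht : 1 ≤ t) :
    (∃ τ, (logProtocol n m V f).view (e.st τ p) t ≠ none) ∧
    (∀ τ r i v, e.AlwaysGood i → (logProtocol n m V f).issued (e.st τ i) t r = some v →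
      ∃ τ', (logProtocol n m V f).accepted (e.st τ' p) t r i = some v) ∧
    (∀ τ r i v, e.board τ t r i = some v →
      ∃ τ', (logProtocol n m V f).accepted (e.st τ' p) t r i = some v) := by
  refine ⟨?_, fun τ r i v hi hv => ?_, fun τ r i v hv => ?_⟩
  · obtain ⟨τ, hτ⟩ := (h.eventually_fixed hf t hp).exists
    obtain ⟨k, x, hx, ho⟩ := ((e.sound hf (hp τ)).fix_iff t).2 ⟨ht, hτ⟩
    refine ⟨τ, ?_⟩
    rw [(e.view_eq_some hf (hp τ)).2 ⟨k, x, hx, ho, rfl⟩]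
    simp
  · obtain ⟨k, x, hx, ho⟩ := (e.issued_eq_some hf (hi τ)).1 hv
    exact hp.exists_accepted hf ho (h.eventually_own hf hi hx hp)
  · obtain ⟨k, x, ⟨σ, _, p', hp', hx⟩, ho⟩ := (e.isHist_board hf τ t r i v).1 hv
    exact hp.exists_accepted hf ho
      ((h.eventually_logs hf hp' hp).mono fun _ hτ => hτ i k x hx)

end Execution

end Blackboard

/-! ### The iterated blackboard theorem -/

theorem mainTheorem2 {V : Type*} (n f m : ℕ) (hf : 3 * f < n) :
    ∃ P : Blackboard.Protocol n m V, ∀ e : Blackboard.Execution P f,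
      -- the true blackboards over time, and the views `BB^{(q,t)}` of the writing processes
      ∃ (BB : ℕ → Blackboard.History m n V) (H : Fin n → ℕ → Blackboard.History m n V),
        e.IsTrueBlackboard BB ∧ e.WritesProperly BB ∧ e.Persistent ∧
        (∀ t ≥ 1,
          -- (1) columns are prefixes of values; a complete matrix has at least `n - f` full columns
          (∀ τ i (r r' : Fin m), r ≤ r' → BB τ t r' i ≠ none → BB τ t r i ≠ none) ∧
          (∀ τ, e.CompleteBy τ t →
            n - f ≤ {i | Blackboard.FullColumn (BB τ t) i}.ncard ∧
            {i | ¬ Blackboard.FullColumn (BB τ t) i}.ncard ≤ f) ∧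
          -- (2) views differ from the truth at last written cells only, at most `f` in total
          (∀ σ p h, e.Good σ p → P.view (e.st σ p) t = some h →
            (∀ τ ≥ σ, Blackboard.AgreesUpToLast (BB τ) t h ∧
              (Blackboard.disagreements t h (BB τ)).encard ≤ f) ∧
            (∀ σ' p' h', e.Good σ' p' → P.view (e.st σ' p') t = some h' →
              (Blackboard.disagreements t h h').encard ≤ f)) ∧
          -- (3) views of the writers to the next matrix are known to all
          (∀ q, e.WritesTo BB q (t + 1) →
            (∀ τ r, e.Good τ q → P.issued (e.st τ q) (t + 1) r ≠ none →
              P.view (e.st τ q) t = some (H q t)) ∧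
            (∀ σ p, e.Good σ p → P.view (e.st σ p) (t + 1) ≠ none →
              P.aware (e.st σ p) q t = some (H q t) ∧
              (e.Good σ q → P.view (e.st σ q) t = some (H q t)) ∧
              (∀ τ ≥ σ, Blackboard.AgreesUpToLast (BB τ) t (H q t) ∧
                (Blackboard.disagreements t (H q t) (BB τ)).encard ≤ f)))) ∧
        -- progress: the series is endless, and all writes reach all good processes
        (e.Fair → ∀ p, e.AlwaysGood p → ∀ t ≥ 1,
          (∃ τ, P.view (e.st τ p) t ≠ none) ∧
          (∀ τ r i v, e.AlwaysGood i → P.issued (e.st τ i) t r = some v →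
            ∃ τ', P.accepted (e.st τ' p) t r i = some v) ∧
          (∀ τ r i v, BB τ t r i = some v →
            ∃ τ', P.accepted (e.st τ' p) t r i = some v)) := by
  refine ⟨Blackboard.logProtocol n m V f, fun e => ⟨e.board, e.knownView,
    e.isTrueBlackboard hf, e.writesProperly hf, e.persistent hf, fun t ht =>
    ⟨e.board_prefix hf t, fun τ hc => ?_, fun σ p h hp hv => ?_, fun q hq =>
      ⟨fun τ r hg hi => e.view_of_issued hf hg ht hi,
        fun σ p hp hv => e.known_of_view hf ht hq hp hv⟩⟩,
    fun hfair p hp t ht => hfair.progress hf hp ht⟩⟩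
  · have h := e.many_full hf hc
    exact ⟨Nat.sub_le_iff_le_add.2 h, Blackboard.many_iff.1 h⟩
  · obtain ⟨k, x, hx, ho, rfl⟩ := (e.view_eq_some hf hp).1 hv
    have hC := ((e.sound hf hp).own_valid k x hx).1
    have hfix := e.own_fixCut hf hp hx ho
    refine ⟨fun τ hτ => ⟨e.fixCut_agrees hf hτ hp hC hfix,
      e.fixCut_disagreements hf hτ hp hC ht hfix⟩, fun σ' p' h' hp' hv' => ?_⟩
    obtain ⟨k', x', hx', ho', rfl⟩ := (e.view_eq_some hf hp').1 hv'
    exact e.fixCut_disagreements_two hf hp hC hp' ((e.sound hf hp').own_valid k' x' hx').1 ht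
      hfix (e.own_fixCut hf hp' hx' ho')
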